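/- **Proposition 3.3 (Yoneda Lemma).** *Conventions.* All $\infty$-categories are strict. An $\infty$-category $L$ has sets $L^n$ of cells of degree $n\ge 0$ ($L^0$ being the objects), maps $d,c:L^{n+1}\to L^n$ with $dc=dd$, $cd=cc$, identities $e:L^n\to L^{n+1}$ with $de=ce=\mathrm{id}$, and partial composites $\circ_k$ ($1\le k\le n$) on $L^n$, where $f\circ_k g$ is defined iff $d^kf=c^kg$; the composites have the usual domains and codomains, are associative and unital, preserve identities ($e(f\circ_k g)=ef\circ_{k+1}eg$), and satisfy the interchange laws, all as equalities. Write $*$ for composition along objects. For objects $a,b$, $L(a,b)$ is the $\infty$-category whose cells of degree $n$ are the $f\in L^{n+1}$ with $d^{n+1}f=a$, $c^{n+1}f=b$; $L^{op}$ is $L$ with composition along objects reversed. A functor preserves degree, $d$, $c$, $e$ and all $\circ_k$. A strict isomorphism is a functor with an inverse functor. Given functors $F,G:K\to K'$, a $0$-modification $F\to G$ is a natural transformation, and an $n$-modification ($n\ge1$) between parallel $(n-1)$-modifications $\alpha_1,\alpha_2$ is a family of cells $\alpha(a):\alpha_1(a)\to\alpha_2(a)$ in $K'^{\,n+1}$,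 $a\in K^0$; for all $n\ge 0$ it is required that $$e^k\alpha(b)*F(f)=G(f)*e^k\alpha(a)\qquad\text{for all } k\ge 0 \text{ and all cells } f \text{ of } K(a,b) \text{ of degree } n+k .$$ Functors $K\to K'$ (degree $0$) and $n$-modifications between them (degree $n+1$) are the cells of an $\infty$-category $\infty\text{-CAT}(K,K')$ with componentwise operations. These are the hom $\infty$-categories of the $\infty$-category $\infty\text{-CAT}$ of small $\infty$-categories, in which $x*y$, for cells $x$ of $\infty\text{-CAT}(K',K'')$ and $y$ of $\infty\text{-CAT}(K,K')$ of equal positive degree, is $a\mapsto x(c_0y(a))*(d_0x)(y(a))$; here $c_0y$ is the functor which is the $0$-dimensional codomain of $y$, and $d_0x$ the functor which is the $0$-dimensional domain of $x$; for functors $*$ is the usual composition. Let $L$ be a small $\infty$-category and let $\mathcal P=\infty\text{-}\mathbb{CAT}(L^{op},\infty\text{-CAT})$ be the $\infty$-category of functors $L^{op}\to\infty\text{-CAT}$ and their modifications (in the next universe). For $a\in L^0$ let $L(-,a)\in\mathcal P^0$ be the functor $b\mapsto L(b,a)$, acting on cells by precomposition, and for a cell $f$ of $L(b,a)$ let $L(-,f):L(-,b)\to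 L(-,a)$ be the cell of $\mathcal P$ given by postcomposition with $f$. *Statement.* For every functor $F:L^{op}\to\infty\text{-CAT}$ and every object $a\in L^0$ there is a strict isomorphism of $\infty$-categories $$\Phi_{a,F}:\ \mathcal P(L(-,a),F)\ \xrightarrow{\ \simeq\ }\ F(a),\qquad \Phi_{a,F}(\tau)=\tau_a(e\,a),$$ for all cells $\tau$ of $\mathcal P(L(-,a),F)$ of all degrees. In particular, the $n$-modifications which are the cells of degree $n$ of $\mathcal P(L(-,a),F)$ correspond bijectively to the cells of degree $n$ of $F(a)$, for every $n\ge 0$. These isomorphisms are natural in $a$ and $F$: for all objects $a,b$ of $L$, all functors $F,G:L^{op}\to\infty\text{-CAT}$, every $n\ge 0$, every cell $f$ of $L(b,a)$ of degree $n$ and every cell $\alpha$ of $\mathcal P(F,G)$ of degree $n$, $$e^n\Phi_{b,G}*\mathcal P(L(-,f),\alpha)=\bigl(\alpha_b*F(f)\bigr)*e^n\Phi_{a,F}$$ as cells of degree $n$ from $\mathcal P(L(-,a),F)$ to $G(b)$ (functors for $n=0$, $(n-1)$-modifications for $n\ge1$), where $\mathcal P(L(-,f),\alpha)$ is the cell $\tau\mapsto\alpha*\tau*L(-,f)$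 from $\mathcal P(L(-,a),F)$ to $\mathcal P(L(-,b),G)$. (Cells $f$, $\alpha$ of different degrees are covered by applying $e$ to the one of lower degree.) -/

import Mathlib

universe u v w z

set_option linter.unusedVariables false

/-- Graded sets `C = ∐ Cⁿ` with operations `d, c` of degree `-1`. -/
structure InfGraph where
  C : ℕ → Type u
  d : ∀ {n : ℕ}, C (n + 1) → C n
  c : ∀ {n : ℕ}, C (n + 1) → C n

namespace InfGraph

variable (G : InfGraph.{u})

/-- The iterated domain `d^(n-i) : Cⁿ → Cⁱ`. -/
def src {i n : ℕ} (h : i ≤ n) : G.C n → G.C i :=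
  Nat.leRec (motive := fun m _ => G.C m → G.C i) id (fun _ _ r x => r (G.d x)) h

/-- The iterated codomain `c^(n-i) : Cⁿ → Cⁱ`. -/
def tgt {i n : ℕ} (h : i ≤ n) : G.C n → G.C i :=
  Nat.leRec (motive := fun m _ => G.C m → G.C i) id (fun _ _ r x => r (G.c x)) h

theorem src_self {n : ℕ} (h : n ≤ n) (x : G.C n) : G.src h x = x := by
  simp [src]

theorem tgt_self {n : ℕ} (h : n ≤ n) (x : G.C n) : G.tgt h x = x := by
  simp [tgt]

theorem src_succ {i n : ℕ} (h : i ≤ n) (h' : i ≤ n + 1) (x : G.C (n + 1)) :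
    G.src h' x = G.src h (G.d x) := by
  simp [src, Nat.leRec_succ _ _ h]

theorem tgt_succ {i n : ℕ} (h : i ≤ n) (h' : i ≤ n + 1) (x : G.C (n + 1)) :
    G.tgt h' x = G.tgt h (G.c x) := by
  simp [tgt, Nat.leRec_succ _ _ h]

end InfGraph

/-- Precategories: globular identities, identities `e`, and partial composites.  For cells
`f, g` of degree `n` the composite `comp i _ f g _` is glued along the cells of degree `i < n`,
so it is the composite `f ∘ₖ g` with `k = n - i`, determined iff `d^k f = c^k g`. -/
structure InfPrecat extends InfGraph.{u} where
  dc : ∀ {n : ℕ} (x : C (n + 2)), d (c x) = d (d x)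
  cd : ∀ {n : ℕ} (x : C (n + 2)), c (d x) = c (c x)
  e : ∀ {n : ℕ}, C n → C (n + 1)
  de : ∀ {n : ℕ} (x : C n), d (e x) = x
  ce : ∀ {n : ℕ} (x : C n), c (e x) = x
  comp : ∀ {n : ℕ} (i : ℕ) (hi : i < n) (f g : C n),
    toInfGraph.src hi.le f = toInfGraph.tgt hi.le g → C n

namespace InfPrecat

variable (G : InfPrecat.{u})

/-- The iterated identity `e^(n-i) : Cⁱ → Cⁿ`. -/
def up {i n : ℕ} (h : i ≤ n) : G.C i → G.C n :=
  Nat.leRec (motive := fun m _ => G.C i → G.C m) id (fun _ _ r x => G.e (r x)) h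

theorem up_self {n : ℕ} (h : n ≤ n) (x : G.C n) : G.up h x = x := by
  simp [up]

theorem up_succ {i n : ℕ} (h : i ≤ n) (h' : i ≤ n + 1) (x : G.C i) :
    G.up h' x = G.e (G.up h x) := by
  simp [up, Nat.leRec_succ _ _ h]

theorem tgt_d {i n : ℕ} (h : i ≤ n) (h' : i ≤ n + 2) (x : G.C (n + 2)) :
    G.tgt (h.trans (Nat.le_succ n)) (G.d x) = G.tgt h' x := by
  rw [G.tgt_succ h, G.tgt_succ (h.trans (Nat.le_succ n)), G.tgt_succ h, G.cd]

theorem src_c {i n : ℕ} (h : i ≤ n) (h' : i ≤ n + 2) (x : G.C (n + 2)) :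
    G.src (h.trans (Nat.le_succ n)) (G.c x) = G.src h' x := by
  rw [G.src_succ h, G.src_succ (h.trans (Nat.le_succ n)), G.src_succ h, G.dc]

theorem tgt_d' {i n : ℕ} (h : i < n) (h₁ : i ≤ n) (h' : i ≤ n + 1) (x : G.C (n + 1)) :
    G.tgt h₁ (G.d x) = G.tgt h' x := by
  obtain ⟨m, rfl⟩ : ∃ m, n = m + 1 := ⟨n - 1, by omega⟩
  exact G.tgt_d (by omega) _ x

theorem src_c' {i n : ℕ} (h : i < n) (h₁ : i ≤ n) (h' : i ≤ n + 1) (x : G.C (n + 1)) :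
    G.src h₁ (G.c x) = G.src h' x := by
  obtain ⟨m, rfl⟩ : ∃ m, n = m + 1 := ⟨n - 1, by omega⟩
  exact G.src_c (by omega) _ x

theorem src_e {i n : ℕ} (h : i ≤ n) (h' : i ≤ n + 1) (x : G.C n) :
    G.src h' (G.e x) = G.src h x := by
  rw [G.src_succ h, G.de]

theorem tgt_e {i n : ℕ} (h : i ≤ n) (h' : i ≤ n + 1) (x : G.C n) :
    G.tgt h' (G.e x) = G.tgt h x := by
  rw [G.tgt_succ h, G.ce]

theorem src_up {i j n : ℕ} (hji : j ≤ i) (hin : i ≤ n) (hjn : j ≤ n) (x : G.C i) :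
    G.src hjn (G.up hin x) = G.src hji x := by
  induction n, hin using Nat.le_induction with
  | base => rw [up_self]
  | succ n hn ih => rw [G.up_succ hn, G.src_e (hji.trans hn), ih]

theorem tgt_up {i j n : ℕ} (hji : j ≤ i) (hin : i ≤ n) (hjn : j ≤ n) (x : G.C i) :
    G.tgt hjn (G.up hin x) = G.tgt hji x := by
  induction n, hin using Nat.le_induction with
  | base => rw [up_self]
  | succ n hn ih => rw [G.up_succ hn, G.tgt_e (hji.trans hn), ih]

theorem src_up0 {i n : ℕ} (hin : i ≤ n) (x : G.C i) : G.src hin (G.up hin x) = x := by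
  rw [G.src_up le_rfl, G.src_self]

theorem tgt_up0 {i n : ℕ} (hin : i ≤ n) (x : G.C i) : G.tgt hin (G.up hin x) = x := by
  rw [G.tgt_up le_rfl, G.tgt_self]

theorem src_src {i j n : ℕ} (hij : i ≤ j) (hjn : j ≤ n) (h : i ≤ n) (x : G.C n) :
    G.src hij (G.src hjn x) = G.src h x := by
  induction n, hjn using Nat.le_induction with
  | base => rw [G.src_self]
  | succ n hn ih => rw [G.src_succ hn, G.src_succ (hij.trans hn), ih]

theorem tgt_tgt {i j n : ℕ} (hij : i ≤ j) (hjn : j ≤ n) (h : i ≤ n) (x : G.C n) :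
    G.tgt hij (G.tgt hjn x) = G.tgt h x := by
  induction n, hjn using Nat.le_induction with
  | base => rw [G.tgt_self]
  | succ n hn ih => rw [G.tgt_succ hn, G.tgt_succ (hij.trans hn), ih]

theorem tgt_src {i j n : ℕ} (hij : i < j) (hjn : j ≤ n) (h : i ≤ n) (x : G.C n) :
    G.tgt hij.le (G.src hjn x) = G.tgt h x := by
  induction n, hjn using Nat.le_induction with
  | base => rw [G.src_self]
  | succ n hn ih => rw [G.src_succ hn, ih (by omega), G.tgt_d' (by omega)]

theorem src_tgt {i j n : ℕ} (hij : i < j) (hjn : j ≤ n) (h : i ≤ n) (x : G.C n) :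
    G.src hij.le (G.tgt hjn x) = G.src h x := by
  induction n, hjn using Nat.le_induction with
  | base => rw [G.tgt_self]
  | succ n hn ih => rw [G.tgt_succ hn, ih (by omega), G.src_c' (by omega)]

theorem up_up {i j n : ℕ} (hij : i ≤ j) (hjn : j ≤ n) (h : i ≤ n) (x : G.C i) :
    G.up hjn (G.up hij x) = G.up h x := by
  induction n, hjn using Nat.le_induction with
  | base => rw [G.up_self]
  | succ n hn ih => rw [G.up_succ hn, G.up_succ (hij.trans hn), ih]

theorem up_e {i n : ℕ} (h : i + 1 ≤ n) (h' : i ≤ n) (x : G.C i) :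
    G.up h (G.e x) = G.up h' x := by
  rw [← G.up_up (Nat.le_succ i) h h', G.up_succ le_rfl, G.up_self]

theorem comp_congr {n i : ℕ} {hi : i < n} {f f' g g' : G.C n} (hf : f = f') (hg : g = g')
    (h : G.src hi.le f = G.tgt hi.le g) :
    G.comp i hi f g h = G.comp i hi f' g' (by rw [← hf, ← hg]; exact h) := by
  subst hf hg; rfl

end InfPrecat

/-- Strict ∞-categories: associativity, unit, and interchange laws (for all composites, and for
identities) hold up to equality. -/
structure InfCat extends InfPrecat.{u} where
  d_comp_top : ∀ {n : ℕ} (hi : n < n + 1) (f g : C (n + 1)) (h),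
    d (comp n hi f g h) = d g
  c_comp_top : ∀ {n : ℕ} (hi : n < n + 1) (f g : C (n + 1)) (h),
    c (comp n hi f g h) = c f
  d_comp : ∀ {n i : ℕ} (hi : i < n) (hi' : i < n + 1) (f g : C (n + 1)) (h) (h'),
    d (comp i hi' f g h) = comp i hi (d f) (d g) h'
  c_comp : ∀ {n i : ℕ} (hi : i < n) (hi' : i < n + 1) (f g : C (n + 1)) (h) (h'),
    c (comp i hi' f g h) = comp i hi (c f) (c g) h'
  e_comp : ∀ {n i : ℕ} (hi : i < n) (hi' : i < n + 1) (f g : C n) (h) (h'),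
    e (comp i hi f g h) = comp i hi' (e f) (e g) h'
  assoc : ∀ {n i : ℕ} (hi : i < n) (f g k : C n) (h₁) (h₂) (h₃) (h₄),
    comp i hi (comp i hi f g h₁) k h₂ = comp i hi f (comp i hi g k h₃) h₄
  unit_left : ∀ {n i : ℕ} (hi : i < n) (f : C n) (h),
    comp i hi (toInfPrecat.up hi.le (toInfGraph.tgt hi.le f)) f h = f
  unit_right : ∀ {n i : ℕ} (hi : i < n) (f : C n) (h),
    comp i hi f (toInfPrecat.up hi.le (toInfGraph.src hi.le f)) h = f
  interchange : ∀ {n i j : ℕ} (hij : i < j) (hj : j < n) (f f' g g' : C n)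
    (h₁) (h₂) (h₃) (h₄) (h₅) (h₆),
    comp i (hij.trans hj) (comp j hj f f' h₁) (comp j hj g g' h₂) h₃ =
      comp j hj (comp i (hij.trans hj) f g h₄) (comp i (hij.trans hj) f' g' h₅) h₆

namespace InfCat

variable (M : InfCat.{u})

theorem src_comp_le {n i j : ℕ} (hi : i < n) (hj : j ≤ i) (hjn : j ≤ n) (f g : M.C n) (h) :
    M.src hjn (M.comp i hi f g h) = M.src hjn g := by
  induction n with
  | zero => omega
  | succ n ih =>
    rw [M.src_succ (by omega), M.src_succ (show j ≤ n by omega)]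
    rcases Nat.lt_succ_iff_lt_or_eq.1 hi with hin | rfl
    · rw [M.d_comp hin hi _ _ h (by
        rw [← M.src_succ (by omega) hi.le, h, M.tgt_d' hin]), ih hin]
    · rw [M.d_comp_top]

theorem tgt_comp_le {n i j : ℕ} (hi : i < n) (hj : j ≤ i) (hjn : j ≤ n) (f g : M.C n) (h) :
    M.tgt hjn (M.comp i hi f g h) = M.tgt hjn f := by
  induction n with
  | zero => omega
  | succ n ih =>
    rw [M.tgt_succ (by omega), M.tgt_succ (show j ≤ n by omega)]
    rcases Nat.lt_succ_iff_lt_or_eq.1 hi with hin | rfl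
    · rw [M.c_comp hin hi _ _ h (by
        rw [← M.tgt_succ (by omega) hi.le, ← h, M.src_c' hin]), ih hin]
    · rw [M.c_comp_top]

theorem src_comp_lt {n i j : ℕ} (hi : i < n) (hj : i < j) (hjn : j ≤ n) (f g : M.C n) (h) (h') :
    M.src hjn (M.comp i hi f g h) = M.comp i hj (M.src hjn f) (M.src hjn g) h' := by
  induction n, hjn using Nat.le_induction with
  | base => simp only [M.src_self]
  | succ n hn ih =>
    have hin : i < n := by omega
    rw [M.src_succ hn, M.d_comp hin hi _ _ h (by
        rw [← M.src_succ (by omega) hi.le, h, M.tgt_d' hin]), ih hin]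
    · apply M.comp_congr <;> rw [M.src_succ hn]
    · rw [M.src_src _ _ hin.le, M.tgt_src hj _ hin.le, ← M.src_succ (by omega) hi.le, h,
        M.tgt_d' hin]

theorem tgt_comp_lt {n i j : ℕ} (hi : i < n) (hj : i < j) (hjn : j ≤ n) (f g : M.C n) (h) (h') :
    M.tgt hjn (M.comp i hi f g h) = M.comp i hj (M.tgt hjn f) (M.tgt hjn g) h' := by
  induction n, hjn using Nat.le_induction with
  | base => simp only [M.tgt_self]
  | succ n hn ih =>
    have hin : i < n := by omega
    rw [M.tgt_succ hn, M.c_comp hin hi _ _ h (by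
        rw [← M.tgt_succ (by omega) hi.le, ← h, M.src_c' hin]), ih hin]
    · apply M.comp_congr <;> rw [M.tgt_succ hn]
    · rw [M.tgt_tgt _ _ hin.le, M.src_tgt hj _ hin.le, ← M.tgt_succ (by omega) hi.le, ← h,
        M.src_c' hin]

theorem up_comp {n m i : ℕ} (hi : i < n) (hnm : n ≤ m) (f g : M.C n) (h) :
    M.up hnm (M.comp i hi f g h) =
      M.comp i (hi.trans_le hnm) (M.up hnm f) (M.up hnm g)
        (by rw [M.src_up hi.le, M.tgt_up hi.le, h]) := by
  induction m, hnm using Nat.le_induction with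
  | base => simp only [M.up_self]
  | succ m hm ih =>
    rw [M.up_succ hm, ih, M.e_comp (hi.trans_le hm) (by omega) _ _ _ (by
      rw [M.src_e (by omega), M.tgt_e (by omega), M.src_up hi.le, M.tgt_up hi.le, h])]
    apply M.comp_congr <;> rw [M.up_succ hm]

theorem unit_left' {n i : ℕ} (hi : i < n) (f g : M.C n) (x : M.C i) (hg : g = M.up hi.le x) (h) :
    M.comp i hi g f h = f := by
  subst hg
  rw [M.src_up0] at h
  subst h
  exact M.unit_left hi f _

theorem unit_right' {n i : ℕ} (hi : i < n) (f g : M.C n) (x : M.C i) (hg : g = M.up hi.le x) (h) :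
    M.comp i hi f g h = f := by
  subst hg
  rw [M.tgt_up0] at h
  subst h
  exact M.unit_right hi f _

theorem comp_mid {n i : ℕ} (hi : i < n) (a p q b r s : M.C n) (hap) (hpq) (hqb) (har) (hrs) (hsb)
    (H₁) (H₂) (E : M.comp i hi p q hpq = M.comp i hi r s hrs) :
    M.comp i hi (M.comp i hi a p hap) (M.comp i hi q b hqb) H₁ =
      M.comp i hi (M.comp i hi a r har) (M.comp i hi s b hsb) H₂ := by
  have g1 : M.src hi.le p = M.tgt hi.le (M.comp i hi q b hqb) := by
    rw [M.tgt_comp_le hi le_rfl, hpq]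
  have g2 : M.src hi.le r = M.tgt hi.le (M.comp i hi s b hsb) := by
    rw [M.tgt_comp_le hi le_rfl, hrs]
  have g3 : M.src hi.le (M.comp i hi p q hpq) = M.tgt hi.le b := by
    rw [M.src_comp_le hi le_rfl, hqb]
  have g4 : M.src hi.le (M.comp i hi r s hrs) = M.tgt hi.le b := by
    rw [M.src_comp_le hi le_rfl, hsb]
  rw [M.assoc hi _ _ _ _ _ g1 (by rw [M.tgt_comp_le hi le_rfl, hap]),
    M.assoc hi _ _ _ _ _ g2 (by rw [M.tgt_comp_le hi le_rfl, har])]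
  refine M.comp_congr rfl ?_ _
  rw [← M.assoc hi _ _ _ hpq g3 hqb g1, ← M.assoc hi _ _ _ hrs g4 hsb g2]
  exact M.comp_congr E rfl _

end InfCat

/-! ### Hom ∞-categories -/

namespace InfCat

variable (L : InfCat.{u})

/-- The graded set `L(a, b)`: its cells of degree `n` are the cells `f` of `L` of degree `n + 1`
with `d^(n+1) f = a` and `c^(n+1) f = b`. -/
abbrev homGraph (a b : L.C 0) : InfGraph.{u} where
  C n := {f : L.C (n + 1) // L.src (Nat.zero_le _) f = a ∧ L.tgt (Nat.zero_le _) f = b}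
  d {n} f := ⟨L.d f.1, by rw [← L.src_succ _ (Nat.zero_le (n + 2))]; exact f.2.1, by
    rw [L.tgt_d' (Nat.succ_pos n) _ (Nat.zero_le (n + 2))]; exact f.2.2⟩
  c {n} f := ⟨L.c f.1, by
    rw [L.src_c' (Nat.succ_pos n) _ (Nat.zero_le (n + 2))]; exact f.2.1, by
    rw [← L.tgt_succ _ (Nat.zero_le (n + 2))]; exact f.2.2⟩

theorem homGraph_src (a b : L.C 0) {i n : ℕ} (h : i ≤ n) (x : (L.homGraph a b).C n) :
    ((L.homGraph a b).src h x).1 = L.src (Nat.succ_le_succ h) x.1 := by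
  induction n, h using Nat.le_induction with
  | base => rw [InfGraph.src_self, InfGraph.src_self]
  | succ n hn ih =>
    rw [InfGraph.src_succ _ hn, ih, L.src_succ (Nat.succ_le_succ hn)]

theorem homGraph_tgt (a b : L.C 0) {i n : ℕ} (h : i ≤ n) (x : (L.homGraph a b).C n) :
    ((L.homGraph a b).tgt h x).1 = L.tgt (Nat.succ_le_succ h) x.1 := by
  induction n, h using Nat.le_induction with
  | base => rw [InfGraph.tgt_self, InfGraph.tgt_self]
  | succ n hn ih =>
    rw [InfGraph.tgt_succ _ hn, ih, L.tgt_succ (Nat.succ_le_succ hn)]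

theorem homGraph_glue {a b : L.C 0} {i n : ℕ} {h : i ≤ n} {f g : (L.homGraph a b).C n}
    (H : (L.homGraph a b).src h f = (L.homGraph a b).tgt h g) :
    L.src (Nat.succ_le_succ h) f.1 = L.tgt (Nat.succ_le_succ h) g.1 := by
  rw [← L.homGraph_src _ _ h, ← L.homGraph_tgt _ _ h, H]

/-- The operations of `L(a, b)` are those of `L`. -/
abbrev homPrecat (a b : L.C 0) : InfPrecat.{u} where
  toInfGraph := L.homGraph a b
  dc x := Subtype.ext (L.dc x.1)
  cd x := Subtype.ext (L.cd x.1)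
  e {n} f := ⟨L.e f.1, by rw [L.src_e (Nat.zero_le _)]; exact f.2.1, by
    rw [L.tgt_e (Nat.zero_le _)]; exact f.2.2⟩
  de x := Subtype.ext (L.de x.1)
  ce x := Subtype.ext (L.ce x.1)
  comp i hi f g h := ⟨L.comp (i + 1) (Nat.succ_lt_succ hi) f.1 g.1 (L.homGraph_glue h), by
    rw [L.src_comp_le _ (Nat.zero_le _)]; exact g.2.1, by
    rw [L.tgt_comp_le _ (Nat.zero_le _)]; exact f.2.2⟩

theorem homPrecat_up (a b : L.C 0) {i n : ℕ} (h : i ≤ n) (x : (L.homPrecat a b).C i) :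
    ((L.homPrecat a b).up h x).1 = L.up (Nat.succ_le_succ h) x.1 := by
  induction n, h using Nat.le_induction with
  | base => rw [InfPrecat.up_self, InfPrecat.up_self]
  | succ n hn ih =>
    rw [InfPrecat.up_succ _ hn, L.up_succ (Nat.succ_le_succ hn), ← ih]

/-- The ∞-category `L(a, b)`, for objects `a, b` of `L`. -/
abbrev Hom (a b : L.C 0) : InfCat.{u} where
  toInfPrecat := L.homPrecat a b
  d_comp_top _ f g _ := Subtype.ext (L.d_comp_top _ f.1 g.1 _)
  c_comp_top _ f g _ := Subtype.ext (L.c_comp_top _ f.1 g.1 _)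
  d_comp hi _ f g _ h' :=
    Subtype.ext (L.d_comp (Nat.succ_lt_succ hi) _ f.1 g.1 _ (L.homGraph_glue h'))
  c_comp hi _ f g _ h' :=
    Subtype.ext (L.c_comp (Nat.succ_lt_succ hi) _ f.1 g.1 _ (L.homGraph_glue h'))
  e_comp hi _ f g _ h' :=
    Subtype.ext (L.e_comp (Nat.succ_lt_succ hi) _ f.1 g.1 _ (L.homGraph_glue h'))
  assoc hi f g k h₁ h₂ h₃ h₄ := Subtype.ext (L.assoc (Nat.succ_lt_succ hi) f.1 g.1 k.1
    (L.homGraph_glue h₁) (L.homGraph_glue h₂) (L.homGraph_glue h₃) (L.homGraph_glue h₄))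
  unit_left hi f h := Subtype.ext (L.unit_left' (Nat.succ_lt_succ hi) f.1 _ _
    (L.homPrecat_up a b hi.le _) (L.homGraph_glue h))
  unit_right hi f h := Subtype.ext (L.unit_right' (Nat.succ_lt_succ hi) f.1 _ _
    (L.homPrecat_up a b hi.le _) (L.homGraph_glue h))
  interchange hij hj f f' g g' h₁ h₂ h₃ h₄ h₅ h₆ := Subtype.ext
    (L.interchange (Nat.succ_lt_succ hij) (Nat.succ_lt_succ hj) f.1 f'.1 g.1 g'.1
      (L.homGraph_glue h₁) (L.homGraph_glue h₂) (L.homGraph_glue h₃) (L.homGraph_glue h₄)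
      (L.homGraph_glue h₅) (L.homGraph_glue h₆))

/-! ### The opposite ∞-category -/

/-- The opposite graph: domain and codomain of cells of degree `1` are interchanged. -/
abbrev opGraph : InfGraph.{u} where
  C := L.C
  d {n} := match n with
    | 0 => L.c
    | _ + 1 => L.d
  c {n} := match n with
    | 0 => L.d
    | _ + 1 => L.c

theorem opGraph_src0 {n : ℕ} (h : 0 < n) (x : L.C n) :
    L.opGraph.src h.le x = L.tgt h.le x := by
  induction n, h using Nat.le_induction with
  | base =>
    rw [InfGraph.src_succ _ le_rfl, InfGraph.src_self, L.tgt_succ le_rfl, L.tgt_self]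
  | succ n hn ih =>
    rw [InfGraph.src_succ _ (Nat.zero_le n), ← L.tgt_d' hn (Nat.zero_le n)]
    obtain ⟨m, rfl⟩ : ∃ m, n = m + 1 := ⟨n - 1, by simp at hn; omega⟩
    exact ih _

theorem opGraph_tgt0 {n : ℕ} (h : 0 < n) (x : L.C n) :
    L.opGraph.tgt h.le x = L.src h.le x := by
  induction n, h using Nat.le_induction with
  | base =>
    rw [InfGraph.tgt_succ _ le_rfl, InfGraph.tgt_self, L.src_succ le_rfl, L.src_self]
  | succ n hn ih =>
    rw [InfGraph.tgt_succ _ (Nat.zero_le n), ← L.src_c' hn (Nat.zero_le n)]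
    obtain ⟨m, rfl⟩ : ∃ m, n = m + 1 := ⟨n - 1, by simp at hn; omega⟩
    exact ih _

theorem opGraph_src {i n : ℕ} (h : i + 1 ≤ n) (x : L.C n) :
    L.opGraph.src h x = L.src h x := by
  induction n, h using Nat.le_induction with
  | base => rw [InfGraph.src_self, InfGraph.src_self]
  | succ n hn ih =>
    rw [InfGraph.src_succ _ hn, L.src_succ hn]
    obtain ⟨m, rfl⟩ : ∃ m, n = m + 1 := ⟨n - 1, by omega⟩
    exact ih _

theorem opGraph_tgt {i n : ℕ} (h : i + 1 ≤ n) (x : L.C n) :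
    L.opGraph.tgt h x = L.tgt h x := by
  induction n, h using Nat.le_induction with
  | base => rw [InfGraph.tgt_self, InfGraph.tgt_self]
  | succ n hn ih =>
    rw [InfGraph.tgt_succ _ hn, L.tgt_succ hn]
    obtain ⟨m, rfl⟩ : ∃ m, n = m + 1 := ⟨n - 1, by omega⟩
    exact ih _

theorem op_glue0 {n : ℕ} {h : 0 < n} {f g : L.C n}
    (H : L.opGraph.src h.le f = L.opGraph.tgt h.le g) : L.src h.le g = L.tgt h.le f := by
  rw [L.opGraph_src0 h, L.opGraph_tgt0 h] at H; exact H.symm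

theorem op_glue {n i : ℕ} {h : i + 1 < n} {f g : L.C n}
    (H : L.opGraph.src h.le f = L.opGraph.tgt h.le g) : L.src h.le f = L.tgt h.le g := by
  rw [L.opGraph_src, L.opGraph_tgt] at H; exact H

/-- Composites along objects are reversed, all other operations are unchanged. -/
abbrev opPrecat : InfPrecat.{u} where
  toInfGraph := L.opGraph
  dc {n} x := match n with
    | 0 => (L.cd x).symm
    | _ + 1 => L.dc x
  cd {n} x := match n with
    | 0 => (L.dc x).symm
    | _ + 1 => L.cd x
  e := L.e
  de {n} x := match n with
    | 0 => L.ce x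
    | _ + 1 => L.de x
  ce {n} x := match n with
    | 0 => L.de x
    | _ + 1 => L.ce x
  comp i := match i with
    | 0 => fun hi f g h => L.comp 0 hi g f (L.op_glue0 (h := hi) h)
    | i + 1 => fun hi f g h => L.comp (i + 1) hi f g (L.op_glue (h := hi) h)

theorem opPrecat_up {i n : ℕ} (h : i ≤ n) (x : L.C i) : L.opPrecat.up h x = L.up h x := by
  induction n, h using Nat.le_induction with
  | base => rw [InfPrecat.up_self]; exact (L.up_self _ _).symm
  | succ n hn ih => rw [InfPrecat.up_succ _ hn, L.up_succ hn, ← ih]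

/-- The opposite ∞-category `Lᵒᵖ`. -/
abbrev op : InfCat.{u} where
  toInfPrecat := L.opPrecat
  d_comp_top {n} hi f g h := match n, f, g, hi, h with
    | 0, f, g, _, h => L.c_comp_top _ g f _
    | _ + 1, f, g, _, h => L.d_comp_top _ f g _
  c_comp_top {n} hi f g h := match n, f, g, hi, h with
    | 0, f, g, _, h => L.d_comp_top _ g f _
    | _ + 1, f, g, _, h => L.c_comp_top _ f g _
  d_comp {n i} hi hi' f g h h' := match n, i, f, g, hi, hi', h, h' with
    | _ + 1, 0, f, g, hi, hi', h, h' => L.d_comp hi hi' g f _ _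
    | _ + 1, _ + 1, f, g, hi, hi', h, h' => L.d_comp hi hi' f g _ _
  c_comp {n i} hi hi' f g h h' := match n, i, f, g, hi, hi', h, h' with
    | _ + 1, 0, f, g, hi, hi', h, h' => L.c_comp hi hi' g f _ _
    | _ + 1, _ + 1, f, g, hi, hi', h, h' => L.c_comp hi hi' f g _ _
  e_comp {n i} hi hi' f g h h' := match i, hi, hi', h, h' with
    | 0, hi, hi', h, h' => L.e_comp hi hi' g f _ _
    | _ + 1, hi, hi', h, h' => L.e_comp hi hi' f g _ _
  assoc {n i} hi f g k h₁ h₂ h₃ h₄ := match i, hi, h₁, h₂, h₃, h₄ with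
    | 0, hi, h₁, h₂, h₃, h₄ => (L.assoc hi k g f _ _
        _ _).symm
    | _ + 1, hi, h₁, h₂, h₃, h₄ => L.assoc hi f g k _ _
        _ _
  unit_left {n i} hi f h := match i, hi, h with
    | 0, hi, h => L.unit_right' hi f _ _ (L.opPrecat_up _ _) _
    | _ + 1, hi, h => L.unit_left' hi f _ _ (L.opPrecat_up _ _) _
  unit_right {n i} hi f h := match i, hi, h with
    | 0, hi, h => L.unit_left' hi f _ _ (L.opPrecat_up _ _) _
    | _ + 1, hi, h => L.unit_right' hi f _ _ (L.opPrecat_up _ _) _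
  interchange {n i j} hij hj f f' g g' h₁ h₂ h₃ h₄ h₅ h₆ :=
    match i, j, hij, hj, h₁, h₂, h₃, h₄, h₅, h₆ with
    | 0, _ + 1, hij, hj, h₁, h₂, h₃, h₄, h₅, h₆ =>
      L.interchange hij hj g g' f f' _ _ _
        _ _ _
    | _ + 1, _ + 1, hij, hj, h₁, h₂, h₃, h₄, h₅, h₆ =>
      L.interchange hij hj f f' g g' _ _ _
        _ _ _

end InfCat

/-! ### Functors -/

/-- (Strict) ∞-functors. -/
@[ext]
structure InfFunctor (K : InfCat.{u}) (K' : InfCat.{v}) where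
  map : ∀ {n : ℕ}, K.C n → K'.C n
  map_d : ∀ {n : ℕ} (x : K.C (n + 1)), map (K.d x) = K'.d (map x)
  map_c : ∀ {n : ℕ} (x : K.C (n + 1)), map (K.c x) = K'.c (map x)
  map_e : ∀ {n : ℕ} (x : K.C n), map (K.e x) = K'.e (map x)
  map_comp : ∀ {n i : ℕ} (hi : i < n) (f g : K.C n) (h) (h'),
    map (K.comp i hi f g h) = K'.comp i hi (map f) (map g) h'

namespace InfFunctor

variable {K : InfCat.{u}} {K' : InfCat.{v}} {K'' : InfCat.{w}}

theorem map_src (F : InfFunctor K K') {i n : ℕ} (h : i ≤ n) (x : K.C n) :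
    F.map (K.src h x) = K'.src h (F.map x) := by
  induction n, h using Nat.le_induction with
  | base => rw [InfGraph.src_self, InfGraph.src_self]
  | succ n hn ih => rw [K.src_succ hn, ih, K'.src_succ hn, F.map_d]

theorem map_tgt (F : InfFunctor K K') {i n : ℕ} (h : i ≤ n) (x : K.C n) :
    F.map (K.tgt h x) = K'.tgt h (F.map x) := by
  induction n, h using Nat.le_induction with
  | base => rw [InfGraph.tgt_self, InfGraph.tgt_self]
  | succ n hn ih => rw [K.tgt_succ hn, ih, K'.tgt_succ hn, F.map_c]

theorem map_up (F : InfFunctor K K') {i n : ℕ} (h : i ≤ n) (x : K.C i) :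
    F.map (K.up h x) = K'.up h (F.map x) := by
  induction n, h using Nat.le_induction with
  | base => rw [InfPrecat.up_self, InfPrecat.up_self]
  | succ n hn ih => rw [K.up_succ hn, K'.up_succ hn, F.map_e, ih]

theorem glue (F : InfFunctor K K') {i n : ℕ} {h : i ≤ n} {f g : K.C n}
    (H : K.src h f = K.tgt h g) : K'.src h (F.map f) = K'.tgt h (F.map g) := by
  rw [← F.map_src, ← F.map_tgt, H]

/-- The identity functor. -/
def id (K : InfCat.{u}) : InfFunctor K K where
  map x := x
  map_d _ := rfl
  map_c _ := rfl
  map_e _ := rfl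
  map_comp _ _ _ _ _ := rfl

/-- The composite `G ∘ F` of functors. -/
def comp (G : InfFunctor K' K'') (F : InfFunctor K K') : InfFunctor K K'' where
  map x := G.map (F.map x)
  map_d x := by rw [F.map_d, G.map_d]
  map_c x := by rw [F.map_c, G.map_c]
  map_e x := by rw [F.map_e, G.map_e]
  map_comp hi f g h h' := by rw [F.map_comp hi f g h (F.glue h), G.map_comp]

end InfFunctor

/-- A (strict) isomorphism of ∞-categories: a functor which has an inverse functor. -/
structure InfIso (K : InfCat.{u}) (K' : InfCat.{v}) where
  hom : InfFunctor K K'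
  inv : InfFunctor K' K
  inv_hom : ∀ {n : ℕ} (x : K.C n), inv.map (hom.map x) = x
  hom_inv : ∀ {n : ℕ} (y : K'.C n), hom.map (inv.map y) = y

/-- The restriction `L(a, b) → L'(F a, F b)` of a functor to hom ∞-categories. -/
def InfFunctor.onHom {K : InfCat.{u}} {K' : InfCat.{v}} (F : InfFunctor K K') (a b : K.C 0)
    {n : ℕ} (f : (K.Hom a b).C n) : (K'.Hom (F.map a) (F.map b)).C n :=
  ⟨F.map f.1, by rw [← F.map_src, f.2.1], by rw [← F.map_tgt, f.2.2]⟩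

/-- Cells of `L(b, a)` as cells of `Lᵒᵖ(a, b)`. -/
def InfCat.homOp {L : InfCat.{u}} {a b : L.C 0} {n : ℕ} (f : (L.Hom b a).C n) :
    (L.op.Hom a b).C n :=
  ⟨f.1, (L.opGraph_src0 (Nat.succ_pos n) f.1).trans f.2.2,
    (L.opGraph_tgt0 (Nat.succ_pos n) f.1).trans f.2.1⟩

section

/-! ### Modifications -/

variable {K : InfCat.{u}} {K' : InfCat.{v}} {K'' : InfCat.{w}} {J : InfCat.{z}}

/-- The naturality condition on a family `α` of cells of degree `n + 1`, with respect to all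
`f : a ⟶ b` in `L(a, b)` of degree at least `n`:
`e^k α(b) * F(f) = G(f) * e^k α(a)`, where `*` is the composite along objects. -/
def IsNatural (F G : InfFunctor K K') (n : ℕ) (α : K.C 0 → K'.C (n + 1)) : Prop :=
  ∀ (m : ℕ) (h : n ≤ m) (f : K.C (m + 1)) (h₁) (h₂),
    K'.comp 0 (Nat.succ_pos m)
        (K'.up (Nat.succ_le_succ h) (α (K.tgt (Nat.zero_le _) f))) (F.map f) h₁ =
      K'.comp 0 (Nat.succ_pos m)
        (G.map f) (K'.up (Nat.succ_le_succ h) (α (K.src (Nat.zero_le _) f))) h₂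

/-- `n`-modifications between (iterated) modifications of functors `F, G`.  A `0`-modification is
a natural transformation `F ⟶ G`.  An `(n+1)`-modification is a natural family of cells
`α(a) : α₁(a) ⟶ α₂(a)` of degree `n + 2`, where `α₁, α₂` are `n`-modifications. -/
def IsModification (F G : InfFunctor K K') : (n : ℕ) → (K.C 0 → K'.C (n + 1)) → Prop
  | 0, α => (∀ a, K'.d (α a) = F.map a ∧ K'.c (α a) = G.map a) ∧ IsNatural F G 0 α
  | n + 1, α => IsModification F G n (fun a => K'.d (α a)) ∧
      IsModification F G n (fun a => K'.c (α a)) ∧ IsNatural F G (n + 1) α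

/-- The type of `n`-modifications, together with the functors they are modifications of. -/
@[ext]
structure Modification (K : InfCat.{u}) (K' : InfCat.{v}) (n : ℕ) where
  dom : InfFunctor K K'
  cod : InfFunctor K K'
  app : K.C 0 → K'.C (n + 1)
  isMod : IsModification dom cod n app

/-- Cells of degree `0` are functors, cells of degree `n + 1` are `n`-modifications. -/
def FunCell (K : InfCat.{u}) (K' : InfCat.{v}) : ℕ → Type (max u v)
  | 0 => InfFunctor K K'
  | n + 1 => Modification K K' n

namespace IsModification

variable {F G H : InfFunctor K K'}

theorem natural {n : ℕ} {α : K.C 0 → K'.C (n + 1)} (h : IsModification F G n α) :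
    IsNatural F G n α := by
  cases n with
  | zero => exact h.2
  | succ n => exact h.2.2

theorem src {n : ℕ} {α : K.C 0 → K'.C (n + 1)} (h : IsModification F G n α) (a : K.C 0) :
    K'.src (Nat.zero_le _) (α a) = F.map a := by
  induction n with
  | zero => rw [K'.src_succ le_rfl, K'.src_self, (h.1 a).1]
  | succ n ih => rw [K'.src_succ (Nat.zero_le _), ih h.1]

theorem tgt {n : ℕ} {α : K.C 0 → K'.C (n + 1)} (h : IsModification F G n α) (a : K.C 0) :
    K'.tgt (Nat.zero_le _) (α a) = G.map a := by
  induction n with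
  | zero => rw [K'.tgt_succ le_rfl, K'.tgt_self, (h.1 a).2]
  | succ n ih => rw [K'.tgt_succ (Nat.zero_le _), ih h.2.1]

end IsModification

namespace FunCell

/-- The component of a cell at an object. -/
def app : {n : ℕ} → FunCell K K' n → K.C 0 → K'.C n
  | 0, F => F.map
  | _ + 1, α => Modification.app α

/-- The functor which is the `0`-dimensional domain. -/
def dom : {n : ℕ} → FunCell K K' n → InfFunctor K K'
  | 0, F => F
  | _ + 1, α => Modification.dom α

/-- The functor which is the `0`-dimensional codomain. -/
def cod : {n : ℕ} → FunCell K K' n → InfFunctor K K'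
  | 0, F => F
  | _ + 1, α => Modification.cod α

theorem ext' {n : ℕ} {x y : FunCell K K' n} (h₁ : x.dom = y.dom) (h₂ : x.cod = y.cod)
    (h : ∀ a, x.app a = y.app a) : x = y := by
  cases n with
  | zero => exact h₁
  | succ n => exact Modification.ext h₁ h₂ (funext h)

theorem src_app {n : ℕ} (x : FunCell K K' n) (a : K.C 0) :
    K'.src (Nat.zero_le _) (x.app a) = x.dom.map a := by
  cases n with
  | zero => exact K'.src_self _ _
  | succ n => exact (Modification.isMod x).src a

theorem tgt_app {n : ℕ} (x : FunCell K K' n) (a : K.C 0) :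
    K'.tgt (Nat.zero_le _) (x.app a) = x.cod.map a := by
  cases n with
  | zero => exact K'.tgt_self _ _
  | succ n => exact (Modification.isMod x).tgt a

end FunCell

/-- Domain and codomain of modifications are taken componentwise. -/
abbrev funGraph (K : InfCat.{u}) (K' : InfCat.{v}) : InfGraph.{max u v} where
  C := FunCell K K'
  d {n} := match n with
    | 0 => fun x => Modification.dom x
    | n + 1 => fun (x : Modification K K' (n + 1)) =>
      (⟨x.dom, x.cod, fun a => K'.d (x.app a), x.isMod.1⟩ : Modification K K' n)
  c {n} := match n with
    | 0 => fun x => Modification.cod x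
    | n + 1 => fun (x : Modification K K' (n + 1)) =>
      (⟨x.dom, x.cod, fun a => K'.c (x.app a), x.isMod.2.1⟩ : Modification K K' n)

namespace FunCell

theorem d_dom {n : ℕ} (x : FunCell K K' (n + 1)) : FunCell.dom ((funGraph K K').d x) = x.dom := by
  cases n <;> rfl

theorem c_cod {n : ℕ} (x : FunCell K K' (n + 1)) : FunCell.cod ((funGraph K K').c x) = x.cod := by
  cases n <;> rfl

theorem d_cod {n : ℕ} (x : FunCell K K' (n + 2)) : FunCell.cod ((funGraph K K').d x) = x.cod :=
  rfl

theorem c_dom {n : ℕ} (x : FunCell K K' (n + 2)) : FunCell.dom ((funGraph K K').c x) = x.dom :=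
  rfl

theorem app_d {n : ℕ} (x : FunCell K K' (n + 1)) (a : K.C 0) :
    FunCell.app ((funGraph K K').d x) a = K'.d (x.app a) := by
  cases n with
  | zero => exact ((Modification.isMod x).1 a).1.symm
  | succ n => rfl

theorem app_c {n : ℕ} (x : FunCell K K' (n + 1)) (a : K.C 0) :
    FunCell.app ((funGraph K K').c x) a = K'.c (x.app a) := by
  cases n with
  | zero => exact ((Modification.isMod x).1 a).2.symm
  | succ n => rfl

theorem app_src {i n : ℕ} (h : i ≤ n) (x : FunCell K K' n) (a : K.C 0) :
    FunCell.app ((funGraph K K').src h x) a = K'.src h (x.app a) := by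
  induction n, h using Nat.le_induction with
  | base => rw [InfGraph.src_self, K'.src_self]
  | succ n hn ih => rw [InfGraph.src_succ _ hn, K'.src_succ hn, ih, app_d]

theorem app_tgt {i n : ℕ} (h : i ≤ n) (x : FunCell K K' n) (a : K.C 0) :
    FunCell.app ((funGraph K K').tgt h x) a = K'.tgt h (x.app a) := by
  induction n, h using Nat.le_induction with
  | base => rw [InfGraph.tgt_self, K'.tgt_self]
  | succ n hn ih => rw [InfGraph.tgt_succ _ hn, K'.tgt_succ hn, ih, app_c]

theorem dom_src {i n : ℕ} (h : i ≤ n) (x : FunCell K K' n) :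
    FunCell.dom ((funGraph K K').src h x) = x.dom := by
  induction n, h using Nat.le_induction with
  | base => rw [InfGraph.src_self]
  | succ n hn ih => rw [InfGraph.src_succ _ hn, ih, d_dom]

theorem cod_tgt {i n : ℕ} (h : i ≤ n) (x : FunCell K K' n) :
    FunCell.cod ((funGraph K K').tgt h x) = x.cod := by
  induction n, h using Nat.le_induction with
  | base => rw [InfGraph.tgt_self]
  | succ n hn ih => rw [InfGraph.tgt_succ _ hn, ih, c_cod]

theorem cod_src {i n : ℕ} (h : i + 1 ≤ n) (x : FunCell K K' n) :
    FunCell.cod ((funGraph K K').src h x) = x.cod := by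
  induction n, h using Nat.le_induction with
  | base => rw [InfGraph.src_self]
  | succ n hn ih =>
    rw [InfGraph.src_succ _ hn, ih]
    obtain ⟨m, rfl⟩ : ∃ m, n = m + 1 := ⟨n - 1, by omega⟩
    rfl

theorem dom_tgt {i n : ℕ} (h : i + 1 ≤ n) (x : FunCell K K' n) :
    FunCell.dom ((funGraph K K').tgt h x) = x.dom := by
  induction n, h using Nat.le_induction with
  | base => rw [InfGraph.tgt_self]
  | succ n hn ih =>
    rw [InfGraph.tgt_succ _ hn, ih]
    obtain ⟨m, rfl⟩ : ∃ m, n = m + 1 := ⟨n - 1, by omega⟩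
    rfl

theorem src_zero {n : ℕ} (h : 0 ≤ n) (x : FunCell K K' n) : (funGraph K K').src h x = x.dom :=
  dom_src h x

theorem tgt_zero {n : ℕ} (h : 0 ≤ n) (x : FunCell K K' n) : (funGraph K K').tgt h x = x.cod :=
  cod_tgt h x

theorem glue {i n : ℕ} {h : i ≤ n} {x y : FunCell K K' n}
    (H : (funGraph K K').src h x = (funGraph K K').tgt h y) (a : K.C 0) :
    K'.src h (x.app a) = K'.tgt h (y.app a) := by
  rw [← app_src, ← app_tgt, H]

theorem glue_zero {n : ℕ} {h : 0 ≤ n} {x y : FunCell K K' n}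
    (H : (funGraph K K').src h x = (funGraph K K').tgt h y) : x.dom = y.cod := by
  rw [← src_zero h, H, tgt_zero]

theorem glue_dom {i n : ℕ} {h : i + 1 ≤ n} {x y : FunCell K K' n}
    (H : (funGraph K K').src h x = (funGraph K K').tgt h y) : x.dom = y.dom := by
  rw [← dom_src h x, H, dom_tgt]

theorem glue_cod {i n : ℕ} {h : i + 1 ≤ n} {x y : FunCell K K' n}
    (H : (funGraph K K').src h x = (funGraph K K').tgt h y) : x.cod = y.cod := by
  rw [← cod_src h x, H, cod_tgt]

theorem glue_of {i n : ℕ} {h : i ≤ n} {x y : FunCell K K' n}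
    (h₀ : i = 0 → x.dom = y.cod) (h₁ : 0 < i → x.dom = y.dom) (h₂ : 0 < i → x.cod = y.cod)
    (H : ∀ a, K'.src h (x.app a) = K'.tgt h (y.app a)) :
    (funGraph K K').src h x = (funGraph K K').tgt h y := by
  cases i with
  | zero => rw [src_zero, tgt_zero, h₀ rfl]
  | succ i =>
    refine ext' (n := i + 1) ?_ ?_ ?_
    · rw [dom_src, dom_tgt, h₁ (Nat.succ_pos i)]
    · rw [cod_src, cod_tgt, h₂ (Nat.succ_pos i)]
    · intro a; rw [app_src, app_tgt, H]

end FunCell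

/-! Identities and composites of modifications are modifications. -/

theorem IsNatural.e {F G : InfFunctor K K'} {n : ℕ} {α : K.C 0 → K'.C (n + 1)}
    (h : IsNatural F G n α) : IsNatural F G (n + 1) (fun a => K'.e (α a)) := by
  intro m hm f h₁ h₂
  have hu : ∀ a, K'.up (Nat.succ_le_succ hm) (K'.e (α a)) =
      K'.up (Nat.succ_le_succ (Nat.le_of_succ_le hm)) (α a) := fun a => K'.up_e _ _ _
  rw [K'.comp_congr (hu _) rfl, K'.comp_congr rfl (hu _)]
  exact h m (Nat.le_of_succ_le hm) f _ _

theorem IsModification.e {F G : InfFunctor K K'} {n : ℕ} {α : K.C 0 → K'.C (n + 1)}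
    (h : IsModification F G n α) : IsModification F G (n + 1) (fun a => K'.e (α a)) := by
  refine ⟨?_, ?_, h.natural.e⟩
  · simpa only [K'.de] using h
  · simpa only [K'.ce] using h

theorem IsModification.id (F : InfFunctor K K') :
    IsModification F F 0 (fun a => K'.e (F.map a)) := by
  refine ⟨fun a => ⟨K'.de _, K'.ce _⟩, ?_⟩
  intro m hm f h₁ h₂
  rw [K'.unit_left' _ _ _ (F.map (K.tgt (Nat.zero_le _) f)) (K'.up_e _ _ _),
    K'.unit_right' _ _ _ (F.map (K.src (Nat.zero_le _) f)) (K'.up_e _ _ _)]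

theorem IsNatural.comp_zero {F G H : InfFunctor K K'} {n : ℕ} {α β : K.C 0 → K'.C (n + 1)}
    (hα : IsModification G H n α) (hβ : IsModification F G n β) (h : ∀ a, _) :
    IsNatural F H n (fun a => K'.comp 0 (Nat.succ_pos n) (α a) (β a) (h a)) := by
  intro m hm f h₁ h₂
  have tu : ∀ (x : K'.C (n + 1)), K'.tgt (Nat.zero_le _) (K'.up (Nat.succ_le_succ hm) x) =
    K'.tgt (Nat.zero_le _) x := fun x => K'.tgt_up _ _ _ _
  have su : ∀ (x : K'.C (n + 1)), K'.src (Nat.zero_le _) (K'.up (Nat.succ_le_succ hm) x) =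
    K'.src (Nat.zero_le _) x := fun x => K'.src_up _ _ _ _
  rw [K'.comp_congr (K'.up_comp _ _ _ _ _) rfl, K'.comp_congr rfl (K'.up_comp _ _ _ _ _)]
  have e₁ := hα.natural m hm f (by rw [su, hα.src, ← G.map_tgt]) (by rw [tu, hα.tgt, ← H.map_src])
  have e₂ := hβ.natural m hm f (by rw [su, hβ.src, ← F.map_tgt]) (by rw [tu, hβ.tgt, ← G.map_src])
  rw [K'.assoc _ _ _ _ _ _ (by rw [su, hβ.src, ← F.map_tgt])
    (by rw [K'.tgt_comp_le _ le_rfl, su, tu, hα.src, hβ.tgt]), K'.comp_congr rfl e₂,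
    ← K'.assoc _ _ _ _ (by rw [su, hα.src, ← G.map_tgt])
    (by rw [K'.src_comp_le _ le_rfl, tu, hβ.tgt, ← G.map_src]), K'.comp_congr e₁ rfl,
    K'.assoc]

theorem IsNatural.comp_succ {F G : InfFunctor K K'} {n i : ℕ} (hi : i + 1 < n + 1)
    {α β : K.C 0 → K'.C (n + 1)}
    (hα : IsModification F G n α) (hβ : IsModification F G n β) (h : ∀ a, _) :
    IsNatural F G n (fun a => K'.comp (i + 1) hi (α a) (β a) (h a)) := by
  intro m hm f h₁ h₂
  have tu : ∀ (x : K'.C (n + 1)), K'.tgt (Nat.zero_le _) (K'.up (Nat.succ_le_succ hm) x) =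
    K'.tgt (Nat.zero_le _) x := fun x => K'.tgt_up _ _ _ _
  have su : ∀ (x : K'.C (n + 1)), K'.src (Nat.zero_le _) (K'.up (Nat.succ_le_succ hm) x) =
    K'.src (Nat.zero_le _) x := fun x => K'.src_up _ _ _ _
  have him : i + 1 ≤ m + 1 := by omega
  have him' : i + 1 < m + 1 := by omega
  -- `f` is composed with the identity of its domain
  have hf : ∀ (T : InfFunctor K K'), T.map f = K'.comp (i + 1) him' (T.map f)
      (T.map (K.up him (K.src him f))) (by
        rw [← T.map_src, ← T.map_tgt, K.tgt_up0]) := by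
    intro T
    rw [K'.unit_right' him' _ _ (T.map (K.src him f)) (T.map_up _ _)]
  have s0 : K.src (Nat.zero_le _) (K.up him (K.src him f)) = K.src (Nat.zero_le _) f := by
    rw [K.src_up (Nat.zero_le _), K.src_src]
  have t0 : K.tgt (Nat.zero_le _) (K.up him (K.src him f)) = K.tgt (Nat.zero_le _) f := by
    rw [K.tgt_up (Nat.zero_le _), K.tgt_src (Nat.succ_pos _)]
  have e₁ := hα.natural m hm f (by rw [su, hα.src, ← F.map_tgt]) (by rw [tu, hα.tgt, ← G.map_src])
  have e₂ := hβ.natural m hm (K.up him (K.src him f)) (by rw [su, hβ.src, ← F.map_tgt])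
    (by rw [tu, hβ.tgt, ← G.map_src])
  rw [K'.comp_congr (congrArg (fun z => K'.up (Nat.succ_le_succ hm) (β z)) t0) rfl,
    K'.comp_congr rfl (congrArg (fun z => K'.up (Nat.succ_le_succ hm) (β z)) s0)] at e₂
  have g1 : K'.src (Nat.zero_le _) (K'.up (Nat.succ_le_succ hm) (β (K.tgt (Nat.zero_le _) f))) =
      K'.tgt (Nat.zero_le _) (F.map (K.up him (K.src him f))) := by
    rw [su, hβ.src, ← F.map_tgt, t0]
  have g2 : K'.src (Nat.zero_le _) (G.map (K.up him (K.src him f))) = K'.tgt (Nat.zero_le _)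
      (K'.up (Nat.succ_le_succ hm) (β (K.src (Nat.zero_le _) f))) := by
    rw [tu, hβ.tgt, ← G.map_src, s0]
  have k1 : K'.src (Nat.zero_le _) (K'.up (Nat.succ_le_succ hm) (α (K.tgt (Nat.zero_le _) f))) =
      K'.tgt (Nat.zero_le _) (F.map f) := by
    rw [su, hα.src, ← F.map_tgt]
  have k2 : K'.src (Nat.zero_le _) (G.map f) = K'.tgt (Nat.zero_le _)
      (K'.up (Nat.succ_le_succ hm) (α (K.src (Nat.zero_le _) f))) := by
    rw [tu, hα.tgt, ← G.map_src]
  have a1 : ∀ z, K'.src him (K'.up (Nat.succ_le_succ hm) (α z)) =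
      K'.tgt him (K'.up (Nat.succ_le_succ hm) (β z)) := by
    intro z
    rw [K'.src_up hi.le, K'.tgt_up hi.le, h]
  have a2 : ∀ (T : InfFunctor K K'), K'.src him (T.map f) =
      K'.tgt him (T.map (K.up him (K.src him f))) := by
    intro T
    rw [← T.map_src, ← T.map_tgt, K.tgt_up0]
  rw [K'.comp_congr (K'.up_comp _ _ _ _ _) (hf F), K'.comp_congr (hf G) (K'.up_comp _ _ _ _ _)]
  rw [K'.interchange (Nat.succ_pos i) him' _ _ _ _ _ _ _ k1 g1 (by
      rw [K'.src_comp_lt _ (Nat.succ_pos i), K'.tgt_comp_lt _ (Nat.succ_pos i)]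
      · exact K'.comp_congr (a1 _) (a2 F) _
      · rw [K'.tgt_src (Nat.succ_pos i), K'.src_src _ _ (Nat.zero_le _), k1]),
    K'.comp_congr e₁ e₂,
    K'.interchange (Nat.succ_pos i) him' _ _ _ _ _ _ _ k2 g2]

theorem IsModification.comp_zero {F G H : InfFunctor K K'} {n : ℕ} {α β : K.C 0 → K'.C (n + 1)}
    (hα : IsModification G H n α) (hβ : IsModification F G n β) (h : ∀ a, _) :
    IsModification F H n (fun a => K'.comp 0 (Nat.succ_pos n) (α a) (β a) (h a)) := by
  induction n with
  | zero =>
    refine ⟨fun a => ⟨?_, ?_⟩, IsNatural.comp_zero hα hβ h⟩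
    · rw [K'.d_comp_top, (hβ.1 a).1]
    · rw [K'.c_comp_top, (hα.1 a).2]
  | succ n ih =>
    refine ⟨?_, ?_, IsNatural.comp_zero hα hβ h⟩
    · convert ih hα.1 hβ.1 (fun a => by rw [hα.1.src, hβ.1.tgt]) using 2 with a
      exact K'.d_comp _ _ _ _ _ _
    · convert ih hα.2.1 hβ.2.1 (fun a => by rw [hα.2.1.src, hβ.2.1.tgt]) using 2 with a
      exact K'.c_comp _ _ _ _ _ _

theorem IsModification.comp_succ {F G : InfFunctor K K'} {n i : ℕ} (hi : i + 1 < n + 1)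
    {α β : K.C 0 → K'.C (n + 1)}
    (hα : IsModification F G n α) (hβ : IsModification F G n β) (h : ∀ a, _) :
    IsModification F G n (fun a => K'.comp (i + 1) hi (α a) (β a) (h a)) := by
  induction n with
  | zero => omega
  | succ n ih =>
    refine ⟨?_, ?_, IsNatural.comp_succ hi hα hβ h⟩
    · rcases Nat.lt_succ_iff_lt_or_eq.1 hi with hin | hin
      · have hd : ∀ a, K'.src hin.le (K'.d (α a)) = K'.tgt hin.le (K'.d (β a)) := fun a => by
          rw [← K'.src_succ hin.le hi.le, h, K'.tgt_d' hin]
        convert ih hin hα.1 hβ.1 hd using 2 with a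
        exact K'.d_comp _ _ _ _ _ _
      · obtain rfl : i = n := by omega
        convert hβ.1 using 2 with a
        exact K'.d_comp_top _ _ _ _
    · rcases Nat.lt_succ_iff_lt_or_eq.1 hi with hin | hin
      · have hd : ∀ a, K'.src hin.le (K'.c (α a)) = K'.tgt hin.le (K'.c (β a)) := fun a => by
          rw [← K'.tgt_succ hin.le hi.le, ← h, K'.src_c' hin]
        convert ih hin hα.2.1 hβ.2.1 hd using 2 with a
        exact K'.c_comp _ _ _ _ _ _
      · obtain rfl : i = n := by omega
        convert hα.2.1 using 2 with a
        exact K'.c_comp_top _ _ _ _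

/-! ### Functor ∞-categories -/


namespace FunCell

/-- Identities are taken componentwise. -/
def e : {n : ℕ} → FunCell K K' n → FunCell K K' (n + 1)
  | 0, F => (⟨F, F, fun a => K'.e (F.map a), IsModification.id F⟩ : Modification K K' 0)
  | n + 1, x => (⟨Modification.dom x, Modification.cod x, fun a => K'.e (Modification.app x a),
      (Modification.isMod x).e⟩ : Modification K K' (n + 1))

/-- Composites of modifications are taken componentwise. -/
def comp : {n : ℕ} → (i : ℕ) → (hi : i < n) → (x y : FunCell K K' n) →
    (funGraph K K').src hi.le x = (funGraph K K').tgt hi.le y → FunCell K K' n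
  | 0, _, hi, _, _, _ => absurd hi (Nat.not_lt_zero _)
  | n + 1, 0, hi, x, y, h => (⟨Modification.dom y, Modification.cod x,
      fun a => K'.comp 0 hi (Modification.app x a) (Modification.app y a) (glue h a),
      IsModification.comp_zero (G := Modification.dom x) (Modification.isMod x)
        (by rw [show Modification.dom x = Modification.cod y from glue_zero h]
            exact Modification.isMod y) _⟩ : Modification K K' n)
  | n + 1, i + 1, hi, x, y, h => (⟨Modification.dom y, Modification.cod x,
      fun a => K'.comp (i + 1) hi (Modification.app x a) (Modification.app y a) (glue h a),
      IsModification.comp_succ hi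
        (by rw [← show Modification.dom x = Modification.dom y from glue_dom h]
            exact Modification.isMod x)
        (by rw [show Modification.cod x = Modification.cod y from glue_cod h]
            exact Modification.isMod y) _⟩ : Modification K K' n)

theorem e_app {n : ℕ} (x : FunCell K K' n) (a : K.C 0) : x.e.app a = K'.e (x.app a) := by
  cases n <;> rfl

theorem e_dom {n : ℕ} (x : FunCell K K' n) : x.e.dom = x.dom := by
  cases n <;> rfl

theorem e_cod {n : ℕ} (x : FunCell K K' n) : x.e.cod = x.cod := by
  cases n <;> rfl

theorem comp_app {n i : ℕ} (hi : i < n) (x y : FunCell K K' n) (h) (a : K.C 0) :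
    (comp i hi x y h).app a = K'.comp i hi (x.app a) (y.app a) (glue h a) := by
  cases n with
  | zero => omega
  | succ n => cases i <;> rfl

theorem comp_dom {n i : ℕ} (hi : i < n) (x y : FunCell K K' n) (h) :
    (comp i hi x y h).dom = y.dom := by
  cases n with
  | zero => omega
  | succ n => cases i <;> rfl

theorem comp_cod {n i : ℕ} (hi : i < n) (x y : FunCell K K' n) (h) :
    (comp i hi x y h).cod = x.cod := by
  cases n with
  | zero => omega
  | succ n => cases i <;> rfl

end FunCell

abbrev funPrecat (K : InfCat.{u}) (K' : InfCat.{v}) : InfPrecat.{max u v} where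
  toInfGraph := funGraph K K'
  dc {n} x := by
    refine FunCell.ext' (n := n) ?_ ?_ fun a => ?_
    · rw [FunCell.d_dom, FunCell.d_dom, FunCell.c_dom, FunCell.d_dom]
    · cases n <;> rfl
    · rw [FunCell.app_d, FunCell.app_c, FunCell.app_d, FunCell.app_d, K'.dc]
  cd {n} x := by
    refine FunCell.ext' (n := n) ?_ ?_ fun a => ?_
    · cases n <;> rfl
    · rw [FunCell.c_cod, FunCell.c_cod, FunCell.c_cod, FunCell.d_cod]
    · rw [FunCell.app_c, FunCell.app_d, FunCell.app_c, FunCell.app_c, K'.cd]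
  e := FunCell.e
  de {n} x := by
    refine FunCell.ext' (n := n) ?_ ?_ fun a => ?_
    · rw [FunCell.d_dom, FunCell.e_dom]
    · cases n <;> rfl
    · rw [FunCell.app_d, FunCell.e_app, K'.de]
  ce {n} x := by
    refine FunCell.ext' (n := n) ?_ ?_ fun a => ?_
    · cases n <;> rfl
    · rw [FunCell.c_cod, FunCell.e_cod]
    · rw [FunCell.app_c, FunCell.e_app, K'.ce]
  comp i hi x y h := FunCell.comp i hi x y h

namespace FunCell

theorem up_app {i n : ℕ} (h : i ≤ n) (x : FunCell K K' i) (a : K.C 0) :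
    FunCell.app ((funPrecat K K').up h x) a = K'.up h (x.app a) := by
  induction n, h using Nat.le_induction with
  | base => rw [InfPrecat.up_self, K'.up_self]
  | succ n hn ih => rw [InfPrecat.up_succ _ hn, K'.up_succ hn, e_app, ih]

theorem up_dom {i n : ℕ} (h : i ≤ n) (x : FunCell K K' i) :
    FunCell.dom ((funPrecat K K').up h x) = x.dom := by
  induction n, h using Nat.le_induction with
  | base => rw [InfPrecat.up_self]
  | succ n hn ih => rw [InfPrecat.up_succ _ hn, e_dom, ih]

theorem up_cod {i n : ℕ} (h : i ≤ n) (x : FunCell K K' i) :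
    FunCell.cod ((funPrecat K K').up h x) = x.cod := by
  induction n, h using Nat.le_induction with
  | base => rw [InfPrecat.up_self]
  | succ n hn ih => rw [InfPrecat.up_succ _ hn, e_cod, ih]

theorem d_cod' {n : ℕ} (hn : 0 < n) (x : FunCell K K' (n + 1)) :
    FunCell.cod ((funGraph K K').d x) = x.cod := by
  obtain ⟨m, rfl⟩ : ∃ m, n = m + 1 := ⟨n - 1, by omega⟩
  rfl

theorem c_dom' {n : ℕ} (hn : 0 < n) (x : FunCell K K' (n + 1)) :
    FunCell.dom ((funGraph K K').c x) = x.dom := by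
  obtain ⟨m, rfl⟩ : ∃ m, n = m + 1 := ⟨n - 1, by omega⟩
  rfl

end FunCell

/-- The ∞-category of functors `K ⟶ K'` and their modifications. -/
abbrev FunCat (K : InfCat.{u}) (K' : InfCat.{v}) : InfCat.{max u v} where
  toInfPrecat := funPrecat K K'
  d_comp_top {n} hi f g h := by
    refine FunCell.ext' (n := n) ?_ ?_ fun a => ?_
    · rw [FunCell.d_dom, FunCell.d_dom, FunCell.comp_dom]
    · rcases n with _ | n
      · rfl
      · rw [FunCell.d_cod, FunCell.d_cod, FunCell.comp_cod, FunCell.glue_cod h]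
    · rw [FunCell.app_d, FunCell.app_d, FunCell.comp_app, K'.d_comp_top]
  c_comp_top {n} hi f g h := by
    refine FunCell.ext' (n := n) ?_ ?_ fun a => ?_
    · rcases n with _ | n
      · rfl
      · rw [FunCell.c_dom, FunCell.c_dom, FunCell.comp_dom, FunCell.glue_dom h]
    · rw [FunCell.c_cod, FunCell.c_cod, FunCell.comp_cod]
    · rw [FunCell.app_c, FunCell.app_c, FunCell.comp_app, K'.c_comp_top]
  d_comp {n i} hi hi' f g h h' := by
    refine FunCell.ext' (n := n) ?_ ?_ fun a => ?_
    · rw [FunCell.d_dom, FunCell.comp_dom, FunCell.comp_dom, FunCell.d_dom]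
    · rw [FunCell.d_cod' (by omega), FunCell.comp_cod, FunCell.comp_cod, FunCell.d_cod' (by omega)]
    · rw [FunCell.app_d, FunCell.comp_app, FunCell.comp_app, K'.d_comp hi]
      · exact K'.comp_congr (FunCell.app_d _ _).symm (FunCell.app_d _ _).symm _
      · rw [← FunCell.app_d, ← FunCell.app_d]; exact FunCell.glue h' a
  c_comp {n i} hi hi' f g h h' := by
    refine FunCell.ext' (n := n) ?_ ?_ fun a => ?_
    · rw [FunCell.c_dom' (by omega), FunCell.comp_dom, FunCell.comp_dom, FunCell.c_dom' (by omega)]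
    · rw [FunCell.c_cod, FunCell.comp_cod, FunCell.comp_cod, FunCell.c_cod]
    · rw [FunCell.app_c, FunCell.comp_app, FunCell.comp_app, K'.c_comp hi]
      · exact K'.comp_congr (FunCell.app_c _ _).symm (FunCell.app_c _ _).symm _
      · rw [← FunCell.app_c, ← FunCell.app_c]; exact FunCell.glue h' a
  e_comp {n i} hi hi' f g h h' := by
    refine FunCell.ext' (n := n + 1) ?_ ?_ fun a => ?_
    · rw [FunCell.e_dom, FunCell.comp_dom, FunCell.comp_dom, FunCell.e_dom]
    · rw [FunCell.e_cod, FunCell.comp_cod, FunCell.comp_cod, FunCell.e_cod]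
    · rw [FunCell.e_app, FunCell.comp_app, FunCell.comp_app, K'.e_comp hi hi']
      · exact K'.comp_congr (FunCell.e_app _ _).symm (FunCell.e_app _ _).symm _
      · rw [← FunCell.e_app, ← FunCell.e_app]; exact FunCell.glue h' a
  assoc {n i} hi f g k h₁ h₂ h₃ h₄ := by
    refine FunCell.ext' (n := n) ?_ ?_ fun a => ?_
    · simp only [FunCell.comp_dom]
    · simp only [FunCell.comp_cod]
    · simp only [FunCell.comp_app]
      exact K'.assoc _ _ _ _ _ _ _ _
  unit_left {n i} hi f h := by
    refine FunCell.ext' (n := n) ?_ ?_ fun a => ?_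
    · rw [FunCell.comp_dom]
    · rw [FunCell.comp_cod, FunCell.up_cod, FunCell.cod_tgt]
    · rw [FunCell.comp_app, K'.unit_left' hi _ _ _ (FunCell.up_app hi.le _ a)]
  unit_right {n i} hi f h := by
    refine FunCell.ext' (n := n) ?_ ?_ fun a => ?_
    · rw [FunCell.comp_dom, FunCell.up_dom, FunCell.dom_src]
    · rw [FunCell.comp_cod]
    · rw [FunCell.comp_app, K'.unit_right' hi _ _ _ (FunCell.up_app hi.le _ a)]
  interchange {n i j} hij hj f f' g g' h₁ h₂ h₃ h₄ h₅ h₆ := by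
    refine FunCell.ext' (n := n) ?_ ?_ fun a => ?_
    · simp only [FunCell.comp_dom]
    · simp only [FunCell.comp_cod]
    · simp only [FunCell.comp_app]
      exact K'.interchange hij hj _ _ _ _ _ _ _ _ _ _

/-! ### The action of cells of functor ∞-categories, and horizontal composites -/

namespace FunCell

theorem act_glue {n : ℕ} (x : FunCell K K' n) (y : K.C n) (h : 0 ≤ n) :
    K'.src h (x.app (K.tgt h y)) = K'.tgt h (x.dom.map y) := by
  rw [x.src_app, ← x.dom.map_tgt]

theorem act_glue' {n : ℕ} (x : FunCell K K' n) (y : K.C n) (h : 0 ≤ n) :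
    K'.src h (x.cod.map y) = K'.tgt h (x.app (K.src h y)) := by
  rw [x.tgt_app, ← x.cod.map_src]

/-- The value of a cell `x` of degree `n` of the functor ∞-category at a cell `y : b ⟶ c` of
degree `n`: for a functor `x` it is `x(y)`, and for a modification `x` of functors `F, G` it is
`x(c) * F(y)`, which is also `G(y) * x(b)`. -/
def act : {n : ℕ} → FunCell K K' n → K.C n → K'.C n
  | 0, F, y => F.map y
  | n + 1, x, y => K'.comp 0 (Nat.succ_pos n) (x.app (K.tgt (Nat.zero_le _) y)) (x.dom.map y)
      (x.act_glue y _)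

theorem act_eq {n : ℕ} (hn : 0 < n) (x : FunCell K K' n) (y : K.C n) : x.act y =
    K'.comp 0 hn (x.app (K.tgt (Nat.zero_le _) y)) (x.dom.map y) (x.act_glue y _) := by
  cases n with
  | zero => omega
  | succ n => rfl

theorem act_eq' {n : ℕ} (hn : 0 < n) (x : FunCell K K' n) (y : K.C n) : x.act y =
    K'.comp 0 hn (x.cod.map y) (x.app (K.src (Nat.zero_le _) y)) (x.act_glue' y _) := by
  cases n with
  | zero => omega
  | succ n =>
    have := (Modification.isMod x).natural n le_rfl y
      (by rw [K'.up_self]; exact x.act_glue y _) (by rw [K'.up_self]; exact x.act_glue' y _)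
    simp only [K'.up_self] at this
    exact this

theorem d_act {n : ℕ} (x : FunCell K K' (n + 1)) (y : K.C (n + 1)) :
    K'.d (x.act y) = FunCell.act ((funGraph K K').d x) (K.d y) := by
  cases n with
  | zero =>
    rw [act_eq (Nat.succ_pos _), K'.d_comp_top, ← InfFunctor.map_d]; rfl
  | succ n =>
    rw [act_eq (Nat.succ_pos _), act_eq (Nat.succ_pos _), K'.d_comp (Nat.succ_pos _) _ _ _ _ (by
      rw [← K'.src_succ _ (Nat.zero_le _), act_glue, K'.tgt_d' (Nat.succ_pos _)])]
    apply K'.comp_congr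
    · rw [app_d, K.tgt_d' (Nat.succ_pos _)]
    · rw [InfFunctor.map_d, d_dom]

theorem c_act {n : ℕ} (x : FunCell K K' (n + 1)) (y : K.C (n + 1)) :
    K'.c (x.act y) = FunCell.act ((funGraph K K').c x) (K.c y) := by
  cases n with
  | zero =>
    rw [act_eq' (Nat.succ_pos _), K'.c_comp_top, ← InfFunctor.map_c]; rfl
  | succ n =>
    rw [act_eq' (Nat.succ_pos _), act_eq' (Nat.succ_pos _), K'.c_comp (Nat.succ_pos _) _ _ _ _ (by
      rw [← K'.tgt_succ _ (Nat.zero_le _), ← act_glue', K'.src_c' (Nat.succ_pos _)])]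
    apply K'.comp_congr
    · rw [InfFunctor.map_c, c_cod]
    · rw [app_c, K.src_c' (Nat.succ_pos _)]

theorem e_act {n : ℕ} (x : FunCell K K' n) (y : K.C n) :
    K'.e (x.act y) = x.e.act (K.e y) := by
  cases n with
  | zero =>
    rw [act_eq (Nat.succ_pos _), K'.unit_left' _ _ _ (x.app y)]
    · rw [InfFunctor.map_e]; rfl
    · rw [e_app, K.tgt_e (Nat.zero_le _), K.tgt_self, K'.up_succ le_rfl, K'.up_self]
  | succ n =>
    rw [act_eq (Nat.succ_pos _), act_eq (Nat.succ_pos _), K'.e_comp _ (Nat.succ_pos _) _ _ _ (by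
      rw [K'.src_e (Nat.zero_le _), K'.tgt_e (Nat.zero_le _), act_glue])]
    apply K'.comp_congr
    · rw [e_app, K.tgt_e (Nat.zero_le _)]
    · rw [InfFunctor.map_e, e_dom]

theorem src_act {i n : ℕ} (h : i ≤ n) (x : FunCell K K' n) (y : K.C n) :
    K'.src h (x.act y) = FunCell.act ((funGraph K K').src h x) (K.src h y) := by
  induction n, h using Nat.le_induction with
  | base => rw [InfGraph.src_self, InfGraph.src_self, InfGraph.src_self]
  | succ n hn ih => rw [InfGraph.src_succ _ hn, InfGraph.src_succ _ hn, InfGraph.src_succ _ hn,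
      d_act, ih]

theorem tgt_act {i n : ℕ} (h : i ≤ n) (x : FunCell K K' n) (y : K.C n) :
    K'.tgt h (x.act y) = FunCell.act ((funGraph K K').tgt h x) (K.tgt h y) := by
  induction n, h using Nat.le_induction with
  | base => rw [InfGraph.tgt_self, InfGraph.tgt_self, InfGraph.tgt_self]
  | succ n hn ih => rw [InfGraph.tgt_succ _ hn, InfGraph.tgt_succ _ hn, InfGraph.tgt_succ _ hn,
      c_act, ih]

theorem up_act {i n : ℕ} (h : i ≤ n) (x : FunCell K K' i) (y : K.C i) :
    K'.up h (x.act y) = FunCell.act ((funPrecat K K').up h x) (K.up h y) := by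
  induction n, h using Nat.le_induction with
  | base => rw [InfPrecat.up_self, InfPrecat.up_self, InfPrecat.up_self]
  | succ n hn ih => rw [InfPrecat.up_succ _ hn, InfPrecat.up_succ _ hn, InfPrecat.up_succ _ hn,
      ih, e_act]

theorem act_comp {n i : ℕ} (hi : i < n) (x x' : FunCell K K' n) (y y' : K.C n) (h₁) (h₂) (h₃) :
    (comp i hi x x' h₁).act (K.comp i hi y y' h₂) =
      K'.comp i hi (x.act y) (x'.act y') h₃ := by
  have hn : 0 < n := by omega
  have t0 : K.tgt hn.le (K.comp i hi y y' h₂) = K.tgt hn.le y :=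
    K.tgt_comp_le hi (Nat.zero_le _) _ _ _ _
  rw [act_eq hn, K'.comp_congr ((comp_app hi x x' h₁ _).trans
    (K'.comp_congr (congrArg x.app t0) (congrArg x'.app t0) _))
    ((congrArg (fun F => InfFunctor.map F _) (comp_dom hi x x' h₁)).trans
      (x'.dom.map_comp hi y y' h₂ (x'.dom.glue h₂)))]
  rcases Nat.eq_zero_or_pos i with rfl | hi0
  · have hd : x.dom = x'.cod := glue_zero h₁
    have h₂' : K.src hn.le y = K.tgt hn.le y' := h₂
    have g1 := x'.act_glue' y hn.le
    have g2 := x'.act_glue y' hn.le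
    have g3 := x.act_glue y hn.le
    have g4 := x'.act_glue y hn.le
    have g5 : K'.src hn.le (x'.dom.map y) = K'.tgt hn.le (x'.dom.map y') := x'.dom.glue h₂
    have g6 : K'.src hn.le (x.app (K.tgt hn.le y)) = K'.tgt hn.le (x'.app (K.tgt hn.le y)) :=
      glue h₁ _
    rw [K'.comp_congr (act_eq hn x y)
      ((act_eq hn x' y').trans (K'.comp_congr (congrArg x'.app h₂'.symm) rfl _))]
    refine K'.comp_mid hn _ _ _ _ _ _ _ g4 _ _ (by rw [hd]; exact g1) _ _ _ ?_
    rw [← act_eq hn, act_eq' hn]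
    exact K'.comp_congr (by rw [hd]) rfl _
  · obtain ⟨i, rfl⟩ : ∃ j, i = j + 1 := ⟨i - 1, by omega⟩
    have hd : x.dom = x'.dom := glue_dom h₁
    have t1 : K.tgt hn.le y = K.tgt hn.le y' := by
      rw [← K.tgt_src (Nat.succ_pos i) hi.le, h₂, K.tgt_tgt]
    have g3 := x.act_glue y hn.le
    have g4 := x'.act_glue y' hn.le
    rw [K'.interchange (Nat.succ_pos i) hi _ _ _ _ _ _ _ (by rw [← hd]; exact g3)
      (by rw [t1]; exact g4) (by
        have := h₃
        rw [act_eq hn, act_eq hn] at this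
        convert this using 3
        · rw [hd]
        · rw [t1])]
    apply K'.comp_congr
    · rw [act_eq hn]; exact K'.comp_congr rfl (by rw [hd]) _
    · rw [act_eq hn]; exact K'.comp_congr (by rw [t1]) rfl _

end FunCell

namespace FunCell

theorem act_app {n : ℕ} (x : FunCell K K' n) (a : K.C 0) :
    x.act (K.up (Nat.zero_le n) a) = x.app a := by
  cases n with
  | zero => rw [K.up_self]; rfl
  | succ n =>
    rw [act_eq (Nat.succ_pos n), K'.unit_right' _ _ _ (x.dom.map a) (x.dom.map_up _ _), K.tgt_up0]

theorem act_comp_right {n : ℕ} (hn : 0 < n) (x : FunCell K K' n) (y z : K.C n) (h) (h') :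
    x.act (K.comp 0 hn y z h) = K'.comp 0 hn (x.act y) (x.dom.map z) h' := by
  have h0 : K.tgt hn.le (K.comp 0 hn y z h) = K.tgt hn.le y := K.tgt_comp_le hn le_rfl _ _ _ _
  have g := x.act_glue y hn.le
  rw [act_eq hn, K'.comp_congr (congrArg x.app h0) (x.dom.map_comp hn y z h (x.dom.glue h)),
    K'.comp_congr (act_eq hn x y) rfl, K'.assoc hn _ _ _ g]

theorem act_comp_left {n : ℕ} (hn : 0 < n) (x : FunCell K K' n) (y z : K.C n) (h) (h') :
    x.act (K.comp 0 hn y z h) = K'.comp 0 hn (x.cod.map y) (x.act z) h' := by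
  have h0 : K.src hn.le (K.comp 0 hn y z h) = K.src hn.le z := K.src_comp_le hn le_rfl _ _ _ _
  have g := x.act_glue' z hn.le
  rw [act_eq' hn, K'.comp_congr (x.cod.map_comp hn y z h (x.cod.glue h)) (congrArg x.app h0),
    K'.comp_congr rfl (act_eq' hn x z), K'.assoc hn _ _ _ (x.cod.glue h) _ g]

theorem isNatural_hcomp {n : ℕ} (x : FunCell K' K'' (n + 1)) (y : FunCell K K' (n + 1)) :
    IsNatural (x.dom.comp y.dom) (x.cod.comp y.cod) n (fun a => x.act (y.app a)) := by
  intro m hm f h₁ h₂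
  obtain ⟨X, hX⟩ : ∃ X : FunCell K' K'' (m + 1), X = (funPrecat K' K'').up (Nat.succ_le_succ hm) x := ⟨_, rfl⟩
  have hXd : FunCell.dom X = x.dom := by rw [hX]; exact up_dom _ _
  have hXc : FunCell.cod X = x.cod := by rw [hX]; exact up_cod _ _
  obtain ⟨Y, hY⟩ : ∃ Y : FunCell K K' (m + 1), Y = (funPrecat K K').up (Nat.succ_le_succ hm) y := ⟨_, rfl⟩
  have hYd : FunCell.dom Y = y.dom := by rw [hY]; exact up_dom _ _
  have hYc : FunCell.cod Y = y.cod := by rw [hY]; exact up_cod _ _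
  have e₂ : ∀ a, K''.up (Nat.succ_le_succ hm) (x.act (y.app a)) =
      FunCell.act X (FunCell.app Y a) := fun a => by rw [up_act, hX, hY, up_app]
  have f₁ : (x.dom.comp y.dom).map f = X.dom.map (Y.dom.map f) := by rw [hXd, hYd]; rfl
  have f₂ : (x.cod.comp y.cod).map f = X.cod.map (Y.cod.map f) := by rw [hXc, hYc]; rfl
  rw [K''.comp_congr (e₂ _) f₁, K''.comp_congr f₂ (e₂ _),
    ← X.act_comp_right (Nat.succ_pos m) _ _ (Y.act_glue f _),
    ← X.act_comp_left (Nat.succ_pos m) _ _ (Y.act_glue' f _), ← act_eq (Nat.succ_pos m),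
    ← act_eq' (Nat.succ_pos m)]

theorem isMod_hcomp {n : ℕ} (x : FunCell K' K'' (n + 1)) (y : FunCell K K' (n + 1)) :
    IsModification (x.dom.comp y.dom) (x.cod.comp y.cod) n (fun a => x.act (y.app a)) := by
  induction n with
  | zero =>
    refine ⟨fun a => ⟨?_, ?_⟩, isNatural_hcomp x y⟩
    · rw [d_act, ← app_d]; rfl
    · rw [c_act, ← app_c]; rfl
  | succ n ih =>
    refine ⟨?_, ?_, isNatural_hcomp x y⟩
    · have h := ih ((funGraph K' K'').d x) ((funGraph K K').d y)
      have e : (fun a => FunCell.act ((funGraph K' K'').d x) (FunCell.app ((funGraph K K').d y) a)) =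
          fun a => K''.d (x.act (y.app a)) := funext fun a => by rw [d_act, ← app_d]
      rw [e] at h
      exact h
    · have h := ih ((funGraph K' K'').c x) ((funGraph K K').c y)
      have e : (fun a => FunCell.act ((funGraph K' K'').c x) (FunCell.app ((funGraph K K').c y) a)) =
          fun a => K''.c (x.act (y.app a)) := funext fun a => by rw [c_act, ← app_c]
      rw [e] at h
      exact h

/-- The composite of cells `x` of `∞-CAT(K', K'')` and `y` of `∞-CAT(K, K')`: it is the composite of
functors in degree `0`, and `a ↦ x(G(a)) * F(y(a))` for modifications, where `G` is the codomain
functor of `y` and `F` is the domain functor of `x`. -/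
def hcomp : {n : ℕ} → FunCell K' K'' n → FunCell K K' n → FunCell K K'' n
  | 0, F, G => InfFunctor.comp F G
  | n + 1, x, y => (⟨InfFunctor.comp (dom x) (dom y), InfFunctor.comp (cod x) (cod y),
      fun a => act x (app y a), isMod_hcomp x y⟩ : Modification K K'' n)

theorem hcomp_dom {n : ℕ} (x : FunCell K' K'' n) (y : FunCell K K' n) :
    (hcomp x y).dom = x.dom.comp y.dom := by
  cases n <;> rfl

theorem hcomp_cod {n : ℕ} (x : FunCell K' K'' n) (y : FunCell K K' n) :
    (hcomp x y).cod = x.cod.comp y.cod := by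
  cases n <;> rfl

theorem hcomp_app {n : ℕ} (x : FunCell K' K'' n) (y : FunCell K K' n) (a : K.C 0) :
    (hcomp x y).app a = x.act (y.app a) := by
  cases n <;> rfl

theorem hcomp_act {n : ℕ} (x : FunCell K' K'' n) (y : FunCell K K' n) (z : K.C n) :
    (hcomp x y).act z = x.act (y.act z) := by
  rcases Nat.eq_zero_or_pos n with rfl | hn
  · rfl
  · have f₁ : (hcomp x y).dom.map z = x.dom.map (y.dom.map z) := by rw [hcomp_dom]; rfl
    have g := y.act_glue z hn.le
    rw [act_eq hn, K''.comp_congr (hcomp_app x y _) f₁, act_eq hn y, x.act_comp_right hn _ _ g]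

theorem hcomp_assoc {n : ℕ} (x : FunCell K'' J n) (y : FunCell K' K'' n) (z : FunCell K K' n) :
    hcomp (hcomp x y) z = hcomp x (hcomp y z) := by
  refine ext' ?_ ?_ fun a => ?_
  · simp only [hcomp_dom]; rfl
  · simp only [hcomp_cod]; rfl
  · simp only [hcomp_app, hcomp_act]

theorem hcomp_d {n : ℕ} (x : FunCell K' K'' (n + 1)) (y : FunCell K K' (n + 1)) :
    (funGraph K K'').d (hcomp x y) = hcomp ((funGraph K' K'').d x) ((funGraph K K').d y) := by
  refine ext' (n := n) ?_ ?_ fun a => ?_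
  · rw [d_dom, hcomp_dom, hcomp_dom, d_dom, d_dom]
  · cases n <;> rfl
  · rw [app_d, hcomp_app, hcomp_app, d_act, app_d]

theorem hcomp_c {n : ℕ} (x : FunCell K' K'' (n + 1)) (y : FunCell K K' (n + 1)) :
    (funGraph K K'').c (hcomp x y) = hcomp ((funGraph K' K'').c x) ((funGraph K K').c y) := by
  refine ext' (n := n) ?_ ?_ fun a => ?_
  · cases n <;> rfl
  · rw [c_cod, hcomp_cod, hcomp_cod, c_cod, c_cod]
  · rw [app_c, hcomp_app, hcomp_app, c_act, app_c]

theorem hcomp_e {n : ℕ} (x : FunCell K' K'' n) (y : FunCell K K' n) :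
    (hcomp x y).e = hcomp x.e y.e := by
  refine ext' ?_ ?_ fun a => ?_
  · simp only [e_dom, hcomp_dom]
  · simp only [e_cod, hcomp_cod]
  · simp only [e_app, hcomp_app, e_act]

theorem hcomp_comp {n i : ℕ} (hi : i < n) (x x' : FunCell K' K'' n) (y y' : FunCell K K' n)
    (h₁) (h₂) (h₃) : hcomp (comp i hi x x' h₁) (comp i hi y y' h₂) =
      comp i hi (hcomp x y) (hcomp x' y') h₃ := by
  refine ext' ?_ ?_ fun a => ?_
  · simp only [comp_dom, hcomp_dom]
  · simp only [comp_cod, hcomp_cod]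
  · have h : K''.src hi.le (x.act (y.app a)) = K''.tgt hi.le (x'.act (y'.app a)) := by
      rw [src_act, tgt_act, h₁, glue h₂]
    rw [hcomp_app, comp_app, comp_app, act_comp hi _ _ _ _ _ _ h]
    exact K''.comp_congr (hcomp_app _ _ _).symm (hcomp_app _ _ _).symm _

/-- The identity functor, as a cell of degree `0`. -/
def idCell (K : InfCat.{u}) : FunCell K K 0 := InfFunctor.id K

theorem hcomp_id_left {n : ℕ} (y : FunCell K K' n) (x : FunCell K' K' n)
    (hx : x = (funPrecat K' K').up (Nat.zero_le n) (idCell K')) : hcomp x y = y := by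
  have hd : x.dom = InfFunctor.id K' := by rw [hx]; exact up_dom _ _
  have hc : x.cod = InfFunctor.id K' := by rw [hx]; exact up_cod _ _
  refine ext' ?_ ?_ fun a => ?_
  · rw [hcomp_dom, hd]; rfl
  · rw [hcomp_cod, hc]; rfl
  · rw [hcomp_app]
    rcases Nat.eq_zero_or_pos n with rfl | hn
    · rw [InfPrecat.up_self] at hx; subst hx; rfl
    · rw [act_eq hn, K'.unit_left' hn _ _ (K'.tgt hn.le (y.app a)), hd]; · rfl
      rw [hx, up_app]; rfl

theorem hcomp_id_right {n : ℕ} (y : FunCell K K' n) (x : FunCell K K n)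
    (hx : x = (funPrecat K K).up (Nat.zero_le n) (idCell K)) : hcomp y x = y := by
  have hd : x.dom = InfFunctor.id K := by rw [hx]; exact up_dom _ _
  have hc : x.cod = InfFunctor.id K := by rw [hx]; exact up_cod _ _
  refine ext' ?_ ?_ fun a => ?_
  · rw [hcomp_dom, hd]; rfl
  · rw [hcomp_cod, hc]; rfl
  · rw [hcomp_app, hx, up_app]
    exact y.act_app a

end FunCell

end

/-! ### The ∞-category of ∞-categories -/

/-- A functor (`n = 0`) or an `(n-1)`-modification (`n > 0`), together with the ∞-categories
between which it acts. -/
structure HCell (n : ℕ) where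
  K : InfCat.{u}
  K' : InfCat.{u}
  x : FunCell K K' n

/-- The cells of the ∞-category of ∞-categories: ∞-categories in degree `0`, functors in degree `1`,
natural transformations in degree `2`, and `n`-modifications in degree `n + 2`. -/
def CATCell : ℕ → Type (u + 1)
  | 0 => InfCat.{u}
  | n + 1 => HCell.{u} n

/-- Transport along equalities of ∞-categories. -/
def FunCell.cast {K₁ K₁' K₂ K₂' : InfCat.{u}} {n : ℕ} (h : K₁ = K₂) (h' : K₁' = K₂')
    (x : FunCell K₁ K₁' n) : FunCell K₂ K₂' n :=
  match K₂, K₂', h, h' with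
  | _, _, rfl, rfl => x

abbrev catGraph : InfGraph.{u + 1} where
  C := CATCell.{u}
  d {n} := match n with
    | 0 => fun (x : HCell 0) => x.K
    | n + 1 => fun (x : HCell (n + 1)) => (⟨x.K, x.K', (funGraph x.K x.K').d x.x⟩ : HCell n)
  c {n} := match n with
    | 0 => fun (x : HCell 0) => x.K'
    | n + 1 => fun (x : HCell (n + 1)) => (⟨x.K, x.K', (funGraph x.K x.K').c x.x⟩ : HCell n)

namespace HCell

/-- Cells of positive degree. -/
def mk' {n : ℕ} (K K' : InfCat.{u}) (x : FunCell K K' n) : CATCell.{u} (n + 1) :=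
  (⟨K, K', x⟩ : HCell n)

/-- Cells of degree `0`. -/
def ob (K : InfCat.{u}) : CATCell.{u} 0 := K

theorem src_mk0 {n : ℕ} {K K' : InfCat.{u}} (x : FunCell K K' n) (h : 0 ≤ n + 1) :
    catGraph.src h (mk' K K' x) = ob K := by
  induction n with
  | zero => rw [InfGraph.src_succ _ le_rfl, InfGraph.src_self]; rfl
  | succ n ih =>
    rw [InfGraph.src_succ _ (Nat.zero_le _)]
    exact ih ((funGraph K K').d x) _

theorem tgt_mk0 {n : ℕ} {K K' : InfCat.{u}} (x : FunCell K K' n) (h : 0 ≤ n + 1) :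
    catGraph.tgt h (mk' K K' x) = ob K' := by
  induction n with
  | zero => rw [InfGraph.tgt_succ _ le_rfl, InfGraph.tgt_self]; rfl
  | succ n ih =>
    rw [InfGraph.tgt_succ _ (Nat.zero_le _)]
    exact ih ((funGraph K K').c x) _

theorem src_mk' {i n : ℕ} (h : i ≤ n) {K K' : InfCat.{u}} (x : FunCell K K' n) :
    catGraph.src (Nat.succ_le_succ h) (mk' K K' x) = mk' K K' ((funGraph K K').src h x) := by
  induction n, h using Nat.le_induction with
  | base => rw [InfGraph.src_self, InfGraph.src_self]
  | succ n hn ih =>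
    rw [InfGraph.src_succ _ (Nat.succ_le_succ hn), InfGraph.src_succ _ hn, ← ih]
    rfl

theorem tgt_mk' {i n : ℕ} (h : i ≤ n) {K K' : InfCat.{u}} (x : FunCell K K' n) :
    catGraph.tgt (Nat.succ_le_succ h) (mk' K K' x) = mk' K K' ((funGraph K K').tgt h x) := by
  induction n, h using Nat.le_induction with
  | base => rw [InfGraph.tgt_self, InfGraph.tgt_self]
  | succ n hn ih =>
    rw [InfGraph.tgt_succ _ (Nat.succ_le_succ hn), InfGraph.tgt_succ _ hn, ← ih]
    rfl

theorem glue0 {n : ℕ} {h : 0 ≤ n + 1} {x y : HCell.{u} n}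
    (H : catGraph.src (n := n + 1) h x = catGraph.tgt (n := n + 1) h y) : x.K = y.K' :=
  (src_mk0 x.x h).symm.trans (Eq.trans H (tgt_mk0 y.x h))

theorem mk'_inj {n : ℕ} {K K' L L' : InfCat.{u}} {x : FunCell K K' n} {y : FunCell L L' n}
    (H : mk' K K' x = mk' L L' y) : ∃ (h : L = K) (h' : L' = K'), x = y.cast h h' := by
  have H' : (⟨K, K', x⟩ : HCell n) = ⟨L, L', y⟩ := H
  cases H'
  exact ⟨rfl, rfl, rfl⟩

theorem glue1 {n i : ℕ} {h : i + 1 ≤ n + 1} {x y : HCell.{u} n}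
    (H : catGraph.src (n := n + 1) h x = catGraph.tgt (n := n + 1) h y) :
    ∃ (e : y.K = x.K) (e' : y.K' = x.K'), (funGraph x.K x.K').src (Nat.le_of_succ_le_succ h) x.x =
      (funGraph x.K x.K').tgt (Nat.le_of_succ_le_succ h) (y.x.cast e e') := by
  obtain ⟨K, K', x⟩ := x
  obtain ⟨L, L', y⟩ := y
  have h1 := src_mk' (Nat.le_of_succ_le_succ h) x
  have h2 := tgt_mk' (Nat.le_of_succ_le_succ h) y
  obtain ⟨e, e', -⟩ := mk'_inj (h1.symm.trans (Eq.trans H h2))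
  obtain rfl : L = K := e
  obtain rfl : L' = K' := e'
  obtain ⟨p, q, E⟩ := mk'_inj (h1.symm.trans (Eq.trans H h2))
  exact ⟨rfl, rfl, E⟩

theorem glue1' {n i : ℕ} {h : i + 1 ≤ n + 1} {K K' : InfCat.{u}} {x y : FunCell K K' n}
    (H : catGraph.src (n := n + 1) h (mk' K K' x) = catGraph.tgt (n := n + 1) h (mk' K K' y)) :
    (funGraph K K').src (Nat.le_of_succ_le_succ h) x =
      (funGraph K K').tgt (Nat.le_of_succ_le_succ h) y :=
  (glue1 H).2.2

/-- Composites along objects are horizontal composites. -/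
def comp0 {n : ℕ} (x y : HCell.{u} n) (h : x.K = y.K') : HCell.{u} n :=
  ⟨y.K, x.K', (x.x.cast h rfl).hcomp y.x⟩

/-- The other composites are those of the functor ∞-categories. -/
def comp1 {n : ℕ} (i : ℕ) (hi : i < n) (x y : HCell.{u} n)
    (h : ∃ (e : y.K = x.K) (e' : y.K' = x.K'), (funGraph x.K x.K').src hi.le x.x =
      (funGraph x.K x.K').tgt hi.le (y.x.cast e e')) : HCell.{u} n :=
  ⟨x.K, x.K', (FunCat x.K x.K').comp i hi x.x (y.x.cast h.1 h.2.1) h.2.2⟩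

end HCell

abbrev catPrecat : InfPrecat.{u + 1} where
  toInfGraph := catGraph.{u}
  dc {n} x := match n, x with
    | 0, x => rfl
    | n + 1, (x : HCell.{u} (n + 2)) =>
      congrArg (HCell.mk' x.K x.K') ((FunCat x.K x.K').dc (n := n) x.x)
  cd {n} x := match n, x with
    | 0, x => rfl
    | n + 1, (x : HCell.{u} (n + 2)) =>
      congrArg (HCell.mk' x.K x.K') ((FunCat x.K x.K').cd (n := n) x.x)
  e {n} := match n with
    | 0 => fun K => HCell.mk' K K (FunCell.idCell K)
    | n + 1 => fun (x : HCell.{u} n) => HCell.mk' x.K x.K' (FunCell.e x.x)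
  de {n} x := match n, x with
    | 0, x => rfl
    | n + 1, (x : HCell.{u} n) =>
      congrArg (HCell.mk' x.K x.K') ((FunCat x.K x.K').de (n := n) x.x)
  ce {n} x := match n, x with
    | 0, x => rfl
    | n + 1, (x : HCell.{u} n) =>
      congrArg (HCell.mk' x.K x.K') ((FunCat x.K x.K').ce (n := n) x.x)
  comp {n} i hi := match n, i, hi with
    | 0, i, hi => absurd hi (Nat.not_lt_zero _)
    | n + 1, 0, hi => fun (x y : HCell.{u} n) h => HCell.comp0 x y (HCell.glue0 h)
    | n + 1, i + 1, hi => fun (x y : HCell.{u} n) h =>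
      HCell.comp1 i (Nat.lt_of_succ_lt_succ hi) x y (HCell.glue1 h)

namespace HCell

theorem up_mk' {i n : ℕ} (h : i ≤ n) {K K' : InfCat.{u}} (x : FunCell K K' i) :
    catPrecat.up (Nat.succ_le_succ h) (mk' K K' x) = mk' K K' ((funPrecat K K').up h x) := by
  induction n, h using Nat.le_induction with
  | base => rw [InfPrecat.up_self, InfPrecat.up_self]
  | succ n hn ih =>
    rw [InfPrecat.up_succ _ (Nat.succ_le_succ hn), InfPrecat.up_succ _ hn, ih]
    rfl

theorem up_zero {n : ℕ} (h : 0 ≤ n + 1) (K : InfCat.{u}) :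
    catPrecat.up h (ob K) =
      mk' K K ((funPrecat K K).up (Nat.zero_le n) (FunCell.idCell K)) := by
  rw [← up_mk', ← InfPrecat.up_up _ (Nat.zero_le 1) (Nat.succ_le_succ (Nat.zero_le n)) h]
  rfl

end HCell

namespace HCell

theorem ex {n : ℕ} (f : CATCell.{u} (n + 1)) : ∃ K K' x, f = mk' K K' x :=
  ⟨HCell.K f, HCell.K' f, HCell.x f, rfl⟩

theorem ex0 {n : ℕ} {h : 0 ≤ n + 1} {K K' : InfCat.{u}} {x : FunCell K K' n}
    {g : CATCell.{u} (n + 1)} (H : catGraph.src h (mk' K K' x) = catGraph.tgt h g) :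
    ∃ J y, g = mk' J K y := by
  obtain ⟨J, L, y, rfl⟩ := ex g
  obtain rfl : K = L := (src_mk0 x h).symm.trans (Eq.trans H (tgt_mk0 y h))
  exact ⟨J, y, rfl⟩

theorem ex1 {n i : ℕ} {h : i + 1 ≤ n + 1} {K K' : InfCat.{u}} {x : FunCell K K' n}
    {g : CATCell.{u} (n + 1)} (H : catGraph.src h (mk' K K' x) = catGraph.tgt h g) :
    ∃ y, g = mk' K K' y := by
  obtain ⟨L, L', y, rfl⟩ := ex g
  obtain ⟨e, e', -⟩ := glue1 H
  obtain rfl : L = K := e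
  obtain rfl : L' = K' := e'
  exact ⟨y, rfl⟩

theorem comp_mk0 {n : ℕ} (hi : 0 < n + 1) {K K' K'' : InfCat.{u}} (x : FunCell K' K'' n)
    (y : FunCell K K' n) (h) :
    catPrecat.comp 0 hi (mk' K' K'' x) (mk' K K' y) h = mk' K K'' (x.hcomp y) := rfl

theorem comp_mk1 {n i : ℕ} (hi : i + 1 < n + 1) {K K' : InfCat.{u}} (x : FunCell K K' n)
    (y : FunCell K K' n) (h) :
    catPrecat.comp (i + 1) hi (mk' K K' x) (mk' K K' y) h =
      mk' K K' (FunCell.comp i (Nat.lt_of_succ_lt_succ hi) x y (glue1' h)) := rfl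

end HCell

section

open HCell

/-- The ∞-category of all (small) ∞-categories, functors, and `n`-modifications. -/
abbrev InfCAT : InfCat.{u + 1} where
  toInfPrecat := catPrecat.{u}
  d_comp_top {n} hi f g h := by
    obtain ⟨K, K', x, rfl⟩ := ex f
    rcases n with _ | n
    · obtain ⟨J, y, rfl⟩ := ex0 h
      rfl
    · obtain ⟨y, rfl⟩ := ex1 h
      exact congrArg (mk' K K') ((FunCat K K').d_comp_top (Nat.lt_succ_self n) x y (glue1' h))
  c_comp_top {n} hi f g h := by
    obtain ⟨K, K', x, rfl⟩ := ex f
    rcases n with _ | n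
    · obtain ⟨J, y, rfl⟩ := ex0 h
      rfl
    · obtain ⟨y, rfl⟩ := ex1 h
      exact congrArg (mk' K K') ((FunCat K K').c_comp_top (Nat.lt_succ_self n) x y (glue1' h))
  d_comp {n i} hi hi' f g h h' := by
    obtain ⟨n, rfl⟩ : ∃ m, n = m + 1 := ⟨n - 1, by omega⟩
    obtain ⟨K, K', x, rfl⟩ := ex f
    rcases i with _ | i
    · obtain ⟨J, y, rfl⟩ := ex0 h
      exact congrArg (mk' J K') (FunCell.hcomp_d x y)
    · obtain ⟨y, rfl⟩ := ex1 h
      exact congrArg (mk' K K') ((FunCat K K').d_comp (Nat.lt_of_succ_lt_succ hi)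
        (Nat.lt_of_succ_lt_succ hi') x y (glue1' h) (glue1' h'))
  c_comp {n i} hi hi' f g h h' := by
    obtain ⟨n, rfl⟩ : ∃ m, n = m + 1 := ⟨n - 1, by omega⟩
    obtain ⟨K, K', x, rfl⟩ := ex f
    rcases i with _ | i
    · obtain ⟨J, y, rfl⟩ := ex0 h
      exact congrArg (mk' J K') (FunCell.hcomp_c x y)
    · obtain ⟨y, rfl⟩ := ex1 h
      exact congrArg (mk' K K') ((FunCat K K').c_comp (Nat.lt_of_succ_lt_succ hi)
        (Nat.lt_of_succ_lt_succ hi') x y (glue1' h) (glue1' h'))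
  e_comp {n i} hi hi' f g h h' := by
    obtain ⟨n, rfl⟩ : ∃ m, n = m + 1 := ⟨n - 1, by omega⟩
    obtain ⟨K, K', x, rfl⟩ := ex f
    rcases i with _ | i
    · obtain ⟨J, y, rfl⟩ := ex0 h
      exact congrArg (mk' J K') (FunCell.hcomp_e x y)
    · obtain ⟨y, rfl⟩ := ex1 h
      exact congrArg (mk' K K') ((FunCat K K').e_comp (Nat.lt_of_succ_lt_succ hi)
        (Nat.lt_of_succ_lt_succ hi') x y (glue1' h) (glue1' h'))
  assoc {n i} hi f g k h₁ h₂ h₃ h₄ := by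
    obtain ⟨n, rfl⟩ : ∃ m, n = m + 1 := ⟨n - 1, by omega⟩
    obtain ⟨K, K', x, rfl⟩ := ex f
    rcases i with _ | i
    · obtain ⟨J, y, rfl⟩ := ex0 h₁
      obtain ⟨I, z, rfl⟩ := ex0 h₃
      exact congrArg (mk' I K') (FunCell.hcomp_assoc x y z)
    · obtain ⟨y, rfl⟩ := ex1 h₁
      obtain ⟨z, rfl⟩ := ex1 h₃
      exact congrArg (mk' K K') ((FunCat K K').assoc (Nat.lt_of_succ_lt_succ hi) x y z
        (glue1' h₁) (glue1' h₂) (glue1' h₃) (glue1' h₄))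
  unit_left {n i} hi f h := by
    obtain ⟨n, rfl⟩ : ∃ m, n = m + 1 := ⟨n - 1, by omega⟩
    obtain ⟨K, K', x, rfl⟩ := ex f
    rcases i with _ | i
    · have e : catPrecat.up hi.le (catGraph.tgt hi.le (mk' K K' x)) = mk' K' K' _ :=
        (congrArg (catPrecat.up hi.le) (tgt_mk0 x hi.le)).trans (up_zero _ _)
      rw [catPrecat.comp_congr e rfl, comp_mk0, FunCell.hcomp_id_left _ _ rfl]
    · have e : catPrecat.up hi.le (catGraph.tgt hi.le (mk' K K' x)) = mk' K K' _ :=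
        (congrArg (catPrecat.up hi.le) (tgt_mk' (Nat.le_of_succ_le_succ hi.le) x)).trans
          (up_mk' (Nat.le_of_succ_le_succ hi.le) _)
      rw [catPrecat.comp_congr e rfl]
      exact congrArg (mk' K K') ((FunCat K K').unit_left (Nat.lt_of_succ_lt_succ hi) x _)
  unit_right {n i} hi f h := by
    obtain ⟨n, rfl⟩ : ∃ m, n = m + 1 := ⟨n - 1, by omega⟩
    obtain ⟨K, K', x, rfl⟩ := ex f
    rcases i with _ | i
    · have e : catPrecat.up hi.le (catGraph.src hi.le (mk' K K' x)) = mk' K K _ :=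
        (congrArg (catPrecat.up hi.le) (src_mk0 x hi.le)).trans (up_zero _ _)
      rw [catPrecat.comp_congr rfl e, comp_mk0, FunCell.hcomp_id_right _ _ rfl]
    · have e : catPrecat.up hi.le (catGraph.src hi.le (mk' K K' x)) = mk' K K' _ :=
        (congrArg (catPrecat.up hi.le) (src_mk' (Nat.le_of_succ_le_succ hi.le) x)).trans
          (up_mk' (Nat.le_of_succ_le_succ hi.le) _)
      rw [catPrecat.comp_congr rfl e]
      exact congrArg (mk' K K') ((FunCat K K').unit_right (Nat.lt_of_succ_lt_succ hi) x _)
  interchange {n i j} hij hj f f' g g' h₁ h₂ h₃ h₄ h₅ h₆ := by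
    obtain ⟨n, rfl⟩ : ∃ m, n = m + 1 := ⟨n - 1, by omega⟩
    obtain ⟨j, rfl⟩ : ∃ m, j = m + 1 := ⟨j - 1, by omega⟩
    obtain ⟨K, K', x, rfl⟩ := ex f
    obtain ⟨x', rfl⟩ := ex1 h₁
    rcases i with _ | i
    · obtain ⟨J, y, rfl⟩ := ex0 h₄
      obtain ⟨y', rfl⟩ := ex1 h₂
      exact congrArg (mk' J K') (FunCell.hcomp_comp (Nat.lt_of_succ_lt_succ hj) x x' y y'
        (glue1' h₁) (glue1' h₂) (glue1' h₆))
    · obtain ⟨y, rfl⟩ := ex1 h₄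
      obtain ⟨y', rfl⟩ := ex1 h₂
      exact congrArg (mk' K K') ((FunCat K K').interchange (Nat.lt_of_succ_lt_succ hij)
        (Nat.lt_of_succ_lt_succ hj) x x' y y' (glue1' h₁) (glue1' h₂) (glue1' h₃) (glue1' h₄)
        (glue1' h₅) (glue1' h₆))

end

/-! ### Functors of two variables -/

/-- A functor `A × B ⟶ D`. -/
structure InfBifunctor (A : InfCat.{u}) (B : InfCat.{v}) (D : InfCat.{w}) where
  map : ∀ {n : ℕ}, A.C n → B.C n → D.C n
  map_d : ∀ {n : ℕ} (x : A.C (n + 1)) (y : B.C (n + 1)), map (A.d x) (B.d y) = D.d (map x y)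
  map_c : ∀ {n : ℕ} (x : A.C (n + 1)) (y : B.C (n + 1)), map (A.c x) (B.c y) = D.c (map x y)
  map_e : ∀ {n : ℕ} (x : A.C n) (y : B.C n), map (A.e x) (B.e y) = D.e (map x y)
  map_comp : ∀ {n i : ℕ} (hi : i < n) (f f' : A.C n) (g g' : B.C n) (h₁) (h₂) (h₃),
    map (A.comp i hi f f' h₁) (B.comp i hi g g' h₂) = D.comp i hi (map f g) (map f' g') h₃

namespace InfBifunctor

variable {A : InfCat.{u}} {B : InfCat.{v}} {D : InfCat.{w}} (μ : InfBifunctor A B D)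

/-- The functor `B × A ⟶ D`. -/
def flip : InfBifunctor B A D where
  map y x := μ.map x y
  map_d y x := μ.map_d x y
  map_c y x := μ.map_c x y
  map_e y x := μ.map_e x y
  map_comp hi f f' g g' h₁ h₂ h₃ := μ.map_comp hi g g' f f' h₂ h₁ h₃

theorem map_src {i n : ℕ} (h : i ≤ n) (x : A.C n) (y : B.C n) :
    μ.map (A.src h x) (B.src h y) = D.src h (μ.map x y) := by
  induction n, h using Nat.le_induction with
  | base => rw [InfGraph.src_self, InfGraph.src_self, InfGraph.src_self]
  | succ n hn ih => rw [A.src_succ hn, B.src_succ hn, ih, D.src_succ hn, μ.map_d]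

theorem map_tgt {i n : ℕ} (h : i ≤ n) (x : A.C n) (y : B.C n) :
    μ.map (A.tgt h x) (B.tgt h y) = D.tgt h (μ.map x y) := by
  induction n, h using Nat.le_induction with
  | base => rw [InfGraph.tgt_self, InfGraph.tgt_self, InfGraph.tgt_self]
  | succ n hn ih => rw [A.tgt_succ hn, B.tgt_succ hn, ih, D.tgt_succ hn, μ.map_c]

theorem map_up {i n : ℕ} (h : i ≤ n) (x : A.C i) (y : B.C i) :
    μ.map (A.up h x) (B.up h y) = D.up h (μ.map x y) := by
  induction n, h using Nat.le_induction with
  | base => rw [InfPrecat.up_self, InfPrecat.up_self, InfPrecat.up_self]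
  | succ n hn ih => rw [A.up_succ hn, B.up_succ hn, D.up_succ hn, μ.map_e, ih]

/-- The functor `x ↦ μ(x, y)`, for an object `y`. -/
def fix (y : B.C 0) : InfFunctor A D where
  map {n} x := μ.map x (B.up (Nat.zero_le n) y)
  map_d {n} x := by rw [← μ.map_d, B.up_succ (Nat.zero_le n), B.de]
  map_c {n} x := by rw [← μ.map_c, B.up_succ (Nat.zero_le n), B.ce]
  map_e {n} x := by rw [← μ.map_e, B.up_succ (Nat.zero_le n)]
  map_comp {n i} hi f g h h' := by
    have e : B.up (Nat.zero_le n) y = B.up hi.le (B.up (Nat.zero_le i) y) :=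
      (B.up_up _ _ _ _).symm
    have k : B.src hi.le (B.up (Nat.zero_le n) y) = B.tgt hi.le (B.up (Nat.zero_le n) y) := by
      rw [e, B.src_up0, B.tgt_up0]
    rw [← μ.map_comp hi f g _ _ h k, B.unit_left' hi _ _ _ e]

theorem isNatural {n : ℕ} (y : B.C (n + 1)) :
    IsNatural (μ.fix (B.src (Nat.zero_le _) y)) (μ.fix (B.tgt (Nat.zero_le _) y)) n
      (fun a => μ.map (A.up (Nat.zero_le _) a) y) := by
  intro m hm f h₁ h₂
  have e : ∀ a, D.up (Nat.succ_le_succ hm) (μ.map (A.up (Nat.zero_le _) a) y) =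
      μ.map (A.up (Nat.zero_le _) a) (B.up (Nat.succ_le_succ hm) y) := fun a => by
    rw [← μ.map_up, A.up_up]
  have s : B.src (Nat.zero_le _) (B.up (Nat.succ_le_succ hm) y) = B.src (Nat.zero_le _) y :=
    B.src_up _ _ _ _
  have t : B.tgt (Nat.zero_le _) (B.up (Nat.succ_le_succ hm) y) = B.tgt (Nat.zero_le _) y :=
    B.tgt_up _ _ _ _
  have e₁ : (μ.fix (B.src (Nat.zero_le _) y)).map f =
      μ.map f (B.up (Nat.zero_le (m + 1)) (B.src (Nat.zero_le _) y)) := rfl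
  have e₂ : (μ.fix (B.tgt (Nat.zero_le _) y)).map f =
      μ.map f (B.up (Nat.zero_le (m + 1)) (B.tgt (Nat.zero_le _) y)) := rfl
  rw [D.comp_congr (e _) e₁, D.comp_congr e₂ (e _),
    ← μ.map_comp (Nat.succ_pos m) _ _ _ _ (A.src_up0 _ _) (by rw [s, B.tgt_up0]),
    ← μ.map_comp (Nat.succ_pos m) _ _ _ _ (A.tgt_up0 _ _).symm (by rw [t, B.src_up0]),
    A.unit_left, A.unit_right, B.unit_right' _ _ _ _ rfl, B.unit_left' _ _ _ _ rfl]

theorem isMod {n : ℕ} (y : B.C (n + 1)) :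
    IsModification (μ.fix (B.src (Nat.zero_le _) y)) (μ.fix (B.tgt (Nat.zero_le _) y)) n
      (fun a => μ.map (A.up (Nat.zero_le _) a) y) := by
  induction n with
  | zero =>
    refine ⟨fun a => ⟨?_, ?_⟩, μ.isNatural y⟩
    · rw [← μ.map_d, A.up_succ le_rfl, A.de, B.src_succ le_rfl, B.src_self, A.up_self]
      exact congrArg _ (B.up_self _ _).symm
    · rw [← μ.map_c, A.up_succ le_rfl, A.ce, B.tgt_succ le_rfl, B.tgt_self, A.up_self]
      exact congrArg _ (B.up_self _ _).symm
  | succ n ih =>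
    have e₁ : (fun a => D.d (μ.map (A.up (Nat.zero_le _) a) y)) =
        fun a => μ.map (A.up (Nat.zero_le (n + 1)) a) (B.d y) := funext fun a => by
      rw [← μ.map_d, A.up_succ (Nat.zero_le _), A.de]
    have e₂ : (fun a => D.c (μ.map (A.up (Nat.zero_le _) a) y)) =
        fun a => μ.map (A.up (Nat.zero_le (n + 1)) a) (B.c y) := funext fun a => by
      rw [← μ.map_c, A.up_succ (Nat.zero_le _), A.ce]
    refine ⟨?_, ?_, μ.isNatural y⟩
    · rw [e₁, B.src_succ (Nat.zero_le _), ← B.tgt_d' (Nat.succ_pos n) (Nat.zero_le _)]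
      exact ih (B.d y)
    · rw [e₂, B.tgt_succ (Nat.zero_le _), ← B.src_c' (Nat.succ_pos n) (Nat.zero_le _)]
      exact ih (B.c y)

/-- The functor or modification `μ(-, y)`, for a cell `y` of `B`. -/
def curry : {n : ℕ} → B.C n → FunCell A D n
  | 0, y => μ.fix y
  | n + 1, y => (⟨μ.fix (B.src (Nat.zero_le _) y), μ.fix (B.tgt (Nat.zero_le _) y),
      fun a => μ.map (A.up (Nat.zero_le _) a) y, μ.isMod y⟩ : Modification A D n)

theorem curry_dom {n : ℕ} (y : B.C n) : (μ.curry y).dom = μ.fix (B.src (Nat.zero_le _) y) := by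
  cases n with
  | zero => rw [B.src_self]; rfl
  | succ n => rfl

theorem curry_cod {n : ℕ} (y : B.C n) : (μ.curry y).cod = μ.fix (B.tgt (Nat.zero_le _) y) := by
  cases n with
  | zero => rw [B.tgt_self]; rfl
  | succ n => rfl

theorem curry_app {n : ℕ} (y : B.C n) (a : A.C 0) :
    (μ.curry y).app a = μ.map (A.up (Nat.zero_le _) a) y := by
  cases n with
  | zero =>
    rw [A.up_self]
    exact congrArg (μ.map a) (B.up_self le_rfl y)
  | succ n => rfl

theorem curry_act {n : ℕ} (y : B.C n) (x : A.C n) : (μ.curry y).act x = μ.map x y := by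
  rcases Nat.eq_zero_or_pos n with rfl | hn
  · exact congrArg (μ.map x) (B.up_self le_rfl y)
  · have e : (μ.curry y).dom.map x = μ.map x (B.up (Nat.zero_le _) (B.src (Nat.zero_le _) y)) := by
      rw [curry_dom]; rfl
    rw [FunCell.act_eq hn, D.comp_congr (μ.curry_app y _) e,
      ← μ.map_comp hn _ _ _ _ (A.src_up0 _ _) (B.tgt_up0 _ _).symm, A.unit_left, B.unit_right]

theorem curry_d {n : ℕ} (y : B.C (n + 1)) :
    (funGraph A D).d (μ.curry y) = μ.curry (B.d y) := by
  refine FunCell.ext' (n := n) ?_ ?_ fun a => ?_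
  · rw [FunCell.d_dom, curry_dom, curry_dom, B.src_succ (Nat.zero_le _)]
  · rcases n with _ | n
    · rw [curry_cod, B.tgt_self, ← B.src_self le_rfl (B.d y), ← B.src_succ]; rfl
    · rw [FunCell.d_cod, curry_cod, curry_cod, B.tgt_d' (Nat.succ_pos _)]
  · rw [FunCell.app_d, curry_app, curry_app, ← μ.map_d, A.up_succ (Nat.zero_le _), A.de]

theorem curry_c {n : ℕ} (y : B.C (n + 1)) :
    (funGraph A D).c (μ.curry y) = μ.curry (B.c y) := by
  refine FunCell.ext' (n := n) ?_ ?_ fun a => ?_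
  · rcases n with _ | n
    · rw [curry_dom, B.src_self, ← B.tgt_self le_rfl (B.c y), ← B.tgt_succ]; rfl
    · rw [FunCell.c_dom, curry_dom, curry_dom, B.src_c' (Nat.succ_pos _)]
  · rw [FunCell.c_cod, curry_cod, curry_cod, B.tgt_succ (Nat.zero_le _)]
  · rw [FunCell.app_c, curry_app, curry_app, ← μ.map_c, A.up_succ (Nat.zero_le _), A.ce]

theorem curry_e {n : ℕ} (y : B.C n) : (μ.curry y).e = μ.curry (B.e y) := by
  refine FunCell.ext' ?_ ?_ fun a => ?_
  · rw [FunCell.e_dom, curry_dom, curry_dom, B.src_e (Nat.zero_le _)]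
  · rw [FunCell.e_cod, curry_cod, curry_cod, B.tgt_e (Nat.zero_le _)]
  · rw [FunCell.e_app, curry_app, curry_app, A.up_succ (Nat.zero_le _), μ.map_e]

theorem curry_up {i n : ℕ} (h : i ≤ n) (y : B.C i) :
    (funPrecat A D).up h (μ.curry y) = μ.curry (B.up h y) := by
  induction n, h using Nat.le_induction with
  | base => rw [InfPrecat.up_self, InfPrecat.up_self]
  | succ n hn ih =>
    rw [InfPrecat.up_succ _ hn, B.up_succ hn, ih]
    exact μ.curry_e _

theorem curry_comp {n i : ℕ} (hi : i < n) (x y : B.C n) (h) (h') :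
    FunCell.comp i hi (μ.curry x) (μ.curry y) h' = μ.curry (B.comp i hi x y h) := by
  refine FunCell.ext' ?_ ?_ fun a => ?_
  · rw [FunCell.comp_dom, curry_dom, curry_dom, B.src_comp_le hi (Nat.zero_le _)]
  · rw [FunCell.comp_cod, curry_cod, curry_cod, B.tgt_comp_le hi (Nat.zero_le _)]
  · have e : A.up (Nat.zero_le n) a = A.up hi.le (A.up (Nat.zero_le i) a) :=
      (A.up_up _ _ _ _).symm
    have k : A.src hi.le (A.up (Nat.zero_le n) a) = A.tgt hi.le (A.up (Nat.zero_le n) a) := by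
      rw [e, A.src_up0, A.tgt_up0]
    rw [FunCell.comp_app, curry_app μ (B.comp i hi x y h), D.comp_congr (μ.curry_app x a) (μ.curry_app y a),
      ← μ.map_comp hi _ _ _ _ k h, A.unit_left' hi _ _ _ e]

end InfBifunctor

/-! ### Representable presheaves -/

namespace InfCat

variable (L : InfCat.{u})

/-- Composition `L(b, c) × L(a, b) ⟶ L(a, c)`. -/
def homComp (a b c : L.C 0) : InfBifunctor (L.Hom b c) (L.Hom a b) (L.Hom a c) where
  map {n} f g := ⟨L.comp 0 (Nat.succ_pos n) f.1 g.1 (f.2.1.trans g.2.2.symm),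
    (L.src_comp_le _ le_rfl _ _ _ _).trans g.2.1, (L.tgt_comp_le _ le_rfl _ _ _ _).trans f.2.2⟩
  map_d f g := Subtype.ext (L.d_comp (Nat.succ_pos _) _ _ _ _ _).symm
  map_c f g := Subtype.ext (L.c_comp (Nat.succ_pos _) _ _ _ _ _).symm
  map_e f g := Subtype.ext (L.e_comp (Nat.succ_pos _) _ _ _ _ _).symm
  map_comp hi f f' g g' h₁ h₂ h₃ := Subtype.ext
    (L.interchange (Nat.succ_pos _) (Nat.succ_lt_succ hi) f.1 f'.1 g.1 g'.1 (L.homGraph_glue h₁)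
      (L.homGraph_glue h₂) _ _ _ (L.homGraph_glue h₃))

/-- `L(f, c) : L(b, c) ⟶ L(a, c)`, `k ↦ k * f`, for a cell `f` of `L(a, b)`. -/
def pre {a b : L.C 0} (c : L.C 0) {n : ℕ} (f : (L.Hom a b).C n) :
    FunCell (L.Hom b c) (L.Hom a c) n :=
  (L.homComp a b c).curry f

/-- `L(a, f) : L(a, b) ⟶ L(a, c)`, `k ↦ f * k`, for a cell `f` of `L(b, c)`. -/
def post (a : L.C 0) {b c : L.C 0} {n : ℕ} (f : (L.Hom b c).C n) :
    FunCell (L.Hom a b) (L.Hom a c) n :=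
  (L.homComp a b c).flip.curry f

/-- The cell `k ↦ g * k * f` of `∞-CAT(L(a, b), L(a', b'))`, for a cell `f` of `L(a', a)` and a
cell `g` of `L(b, b')`. -/
def homMap {a a' b b' : L.C 0} {n : ℕ} (f : (L.Hom a' a).C n) (g : (L.Hom b b').C n) :
    FunCell (L.Hom a b) (L.Hom a' b') n :=
  (L.post a' g).hcomp (L.pre b f)

/-- The identity of `a`, as an object of `L(a, a)`. -/
def idHom (a : L.C 0) : (L.Hom a a).C 0 :=
  ⟨L.e a, (L.src_e le_rfl _ _).trans (L.src_self _ _), (L.tgt_e le_rfl _ _).trans (L.tgt_self _ _)⟩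

theorem hcomp_post_pre {a b c s : L.C 0} {n : ℕ} (f : (L.Hom b c).C n) (g : (L.Hom s a).C n) :
    (L.post s f).hcomp (L.pre b g) = (L.pre c g).hcomp (L.post a f) := by
  refine FunCell.ext' ?_ ?_ fun k => ?_
  · rw [FunCell.hcomp_dom, FunCell.hcomp_dom, pre, pre, post, post]
    simp only [InfBifunctor.curry_dom]
    refine InfFunctor.ext ?_
    funext m k
    exact Subtype.ext (L.assoc _ _ _ _ _ _ _ _).symm
  · rw [FunCell.hcomp_cod, FunCell.hcomp_cod, pre, pre, post, post]
    simp only [InfBifunctor.curry_cod]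
    refine InfFunctor.ext ?_
    funext m k
    exact Subtype.ext (L.assoc _ _ _ _ _ _ _ _).symm
  · rw [FunCell.hcomp_app, FunCell.hcomp_app, pre, pre, post, post]
    simp only [InfBifunctor.curry_app, InfBifunctor.curry_act]
    exact Subtype.ext (L.assoc _ _ _ _ _ _ _ _).symm

theorem hcomp_pre {a b c s : L.C 0} {n : ℕ} (f : (L.Hom a b).C n) (g : (L.Hom b c).C n) :
    (L.pre s f).hcomp (L.pre s g) = L.pre s ((L.homComp a b c).map g f) := by
  have fix : ∀ (x : (L.Hom a b).C 0) (y : (L.Hom b c).C 0) (m : ℕ) (k : (L.Hom c s).C m),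
      ((L.homComp a b s).fix x).map (((L.homComp b c s).fix y).map k) =
        ((L.homComp a c s).fix ((L.homComp a b c).map y x)).map k := by
    intro x y m k
    refine Subtype.ext ((L.assoc (Nat.succ_pos m) k.1 ((L.Hom b c).up (Nat.zero_le m) y).1
      ((L.Hom a b).up (Nat.zero_le m) x).1 _ _ ?_ ?_).trans (L.comp_congr rfl
      (congrArg Subtype.val ((L.homComp a b c).map_up (Nat.zero_le m) y x)) _))
    · exact ((L.Hom b c).up _ y).2.1.trans ((L.Hom a b).up _ x).2.2.symm
    · exact k.2.1.trans ((L.homComp a b c).map _ _).2.2.symm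
  refine FunCell.ext' ?_ ?_ fun k => ?_
  · rw [FunCell.hcomp_dom, pre, pre, pre]
    simp only [InfBifunctor.curry_dom]
    refine InfFunctor.ext ?_
    funext m k
    exact (fix _ _ _ _).trans (congrArg (fun z => ((L.homComp a c s).fix z).map k)
      ((L.homComp a b c).map_src _ _ _))
  · rw [FunCell.hcomp_cod, pre, pre, pre]
    simp only [InfBifunctor.curry_cod]
    refine InfFunctor.ext ?_
    funext m k
    exact (fix _ _ _ _).trans (congrArg (fun z => ((L.homComp a c s).fix z).map k)
      ((L.homComp a b c).map_tgt _ _ _))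
  · rw [FunCell.hcomp_app, pre, pre, pre]
    simp only [InfBifunctor.curry_app, InfBifunctor.curry_act]
    exact Subtype.ext (L.assoc _ _ _ _ _ _ _ _)

theorem pre_id {a s : L.C 0} : L.pre s (L.idHom a) = FunCell.idCell (L.Hom a s) := by
  refine InfFunctor.ext ?_
  funext m k
  refine Subtype.ext (L.unit_right' (Nat.succ_pos m) _ _ a ?_ _)
  exact (L.homPrecat_up a a _ _).trans (L.up_e _ _ _)

/-- The cell `L(f, a)` of `∞-CAT`, for a cell `f` of positive degree. -/
def yoCell (a : L.C 0) {n : ℕ} (f : L.C (n + 1)) : CATCell.{u} (n + 1) :=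
  HCell.mk' (L.Hom (L.tgt (Nat.zero_le _) f) a) (L.Hom (L.src (Nat.zero_le _) f) a)
    (L.pre a ⟨f, rfl, rfl⟩)

theorem yoCell_eq (a : L.C 0) {n : ℕ} {s t : L.C 0} (f : (L.Hom s t).C n) :
    L.yoCell a f.1 = HCell.mk' (L.Hom t a) (L.Hom s a) (L.pre a f) := by
  obtain ⟨f, rfl, rfl⟩ := f
  rfl

/-- The presheaf `L(-, a)`, with `b ↦ L(b, a)` on objects, and `f ↦ L(f, a)`. -/
def yo (a : L.C 0) : InfFunctor L.op InfCAT.{u} where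
  map {n} := match n with
    | 0 => fun (b : L.C 0) => HCell.ob (L.Hom b a)
    | n + 1 => fun (f : L.C (n + 1)) => L.yoCell a f
  map_d {n} f := by
    rcases n with _ | n
    · have e : L.c f = L.tgt (Nat.zero_le 1) f := by rw [L.tgt_succ le_rfl, L.tgt_self]
      exact congrArg (fun b => HCell.ob (L.Hom b a)) e
    · exact (L.yoCell_eq a ((L.Hom (L.src (Nat.zero_le _) f) (L.tgt (Nat.zero_le _) f)).d
        ⟨f, rfl, rfl⟩)).trans (congrArg (HCell.mk' _ _) (InfBifunctor.curry_d _ _).symm)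
  map_c {n} f := by
    rcases n with _ | n
    · have e : L.d f = L.src (Nat.zero_le 1) f := by rw [L.src_succ le_rfl, L.src_self]
      exact congrArg (fun b => HCell.ob (L.Hom b a)) e
    · exact (L.yoCell_eq a ((L.Hom (L.src (Nat.zero_le _) f) (L.tgt (Nat.zero_le _) f)).c
        ⟨f, rfl, rfl⟩)).trans (congrArg (HCell.mk' _ _) (InfBifunctor.curry_c _ _).symm)
  map_e {n} f := by
    rcases n with _ | n
    · exact (L.yoCell_eq a (L.idHom f)).trans (congrArg (HCell.mk' _ _) L.pre_id)
    · exact (L.yoCell_eq a ((L.Hom (L.src (Nat.zero_le _) f) (L.tgt (Nat.zero_le _) f)).e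
        ⟨f, rfl, rfl⟩)).trans (congrArg (HCell.mk' _ _) (InfBifunctor.curry_e _ _).symm)
  map_comp {n i} hi f g h h' := by
    obtain ⟨n, rfl⟩ : ∃ m, n = m + 1 := ⟨n - 1, by omega⟩
    rcases i with _ | i
    · have h₀ : L.src hi.le g = L.tgt hi.le f := L.op_glue0 (h := hi) h
      obtain ⟨t, ht⟩ : ∃ t, t = L.tgt hi.le f := ⟨_, rfl⟩
      let f' : (L.Hom (L.src hi.le f) t).C n := ⟨f, rfl, ht.symm⟩
      let g' : (L.Hom t (L.tgt hi.le g)).C n := ⟨g, h₀.trans ht.symm, rfl⟩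
      have ef := L.yoCell_eq a f'
      have eg := L.yoCell_eq a g'
      refine (L.yoCell_eq a ((L.homComp _ _ _).map g' f')).trans ?_
      refine Eq.trans ?_ (catPrecat.comp_congr ef eg h').symm
      exact congrArg (HCell.mk' _ _) (L.hcomp_pre f' g').symm
    · have h₀ : L.src hi.le f = L.tgt hi.le g := L.op_glue (h := hi) h
      obtain ⟨s, hs⟩ : ∃ s, s = L.src (Nat.zero_le _) f := ⟨_, rfl⟩
      obtain ⟨t, ht⟩ : ∃ t, t = L.tgt (Nat.zero_le _) f := ⟨_, rfl⟩
      let f' : (L.Hom s t).C n := ⟨f, hs.symm, ht.symm⟩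
      let g' : (L.Hom s t).C n := ⟨g, by
        rw [hs, ← L.src_tgt (Nat.succ_pos i) hi.le (Nat.zero_le _) g, ← h₀, L.src_src], by
        rw [ht, ← L.tgt_src (Nat.succ_pos i) hi.le (Nat.zero_le _) f, h₀, L.tgt_tgt]⟩
      have hg : (L.Hom s t).src (Nat.le_of_succ_le_succ hi.le) f' =
          (L.Hom s t).tgt (Nat.le_of_succ_le_succ hi.le) g' := Subtype.ext (by
        rw [L.homGraph_src, L.homGraph_tgt]; exact h₀)
      have ef := L.yoCell_eq a f'
      have eg := L.yoCell_eq a g'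
      refine (L.yoCell_eq a ((L.Hom s t).comp i (Nat.lt_of_succ_lt_succ hi) f' g' hg)).trans ?_
      refine Eq.trans ?_ (catPrecat.comp_congr ef eg h').symm
      exact congrArg (HCell.mk' _ _) (InfBifunctor.curry_comp _ _ _ _ hg _).symm

theorem isNatural_yo {a b : L.C 0} {n : ℕ} (f : (L.Hom b a).C n) :
    IsNatural (L.yo b) (L.yo a) n
      (fun c : L.C 0 => HCell.mk' (L.Hom c b) (L.Hom c a) (L.post c f)) := by
  intro m hm g h₁ h₂
  have es : L.op.src (Nat.zero_le (m + 1)) g = L.tgt (Nat.zero_le _) g :=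
    L.opGraph_src0 (Nat.succ_pos m) g
  have et : L.op.tgt (Nat.zero_le (m + 1)) g = L.src (Nat.zero_le _) g :=
    L.opGraph_tgt0 (Nat.succ_pos m) g
  have e : ∀ c d : L.C 0, c = d → InfCAT.up (Nat.succ_le_succ hm)
      (HCell.mk' (L.Hom c b) (L.Hom c a) (L.post c f)) =
      HCell.mk' (L.Hom d b) (L.Hom d a) (L.post d ((L.Hom b a).up hm f)) := by
    rintro c _ rfl
    exact (HCell.up_mk' hm _).trans (congrArg (HCell.mk' _ _) (InfBifunctor.curry_up _ _ _))
  refine (InfCAT.comp_congr (e _ _ et) rfl h₁).trans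
    (Eq.trans ?_ (InfCAT.comp_congr rfl (e _ _ es) h₂).symm)
  exact congrArg (HCell.mk' _ _) (L.hcomp_post_pre ((L.Hom b a).up hm f) ⟨g, rfl, rfl⟩)

theorem isMod_yo {a b : L.C 0} {n : ℕ} (f : (L.Hom b a).C n) :
    IsModification (L.yo b) (L.yo a) n
      (fun c : L.C 0 => HCell.mk' (L.Hom c b) (L.Hom c a) (L.post c f)) := by
  induction n with
  | zero => exact ⟨fun c => ⟨rfl, rfl⟩, L.isNatural_yo f⟩
  | succ n ih =>
    refine ⟨?_, ?_, L.isNatural_yo f⟩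
    · have e : (fun c : L.C 0 => InfCAT.d (HCell.mk' (L.Hom c b) (L.Hom c a) (L.post c f))) =
          fun c : L.C 0 => HCell.mk' (L.Hom c b) (L.Hom c a) (L.post c ((L.Hom b a).d f)) :=
        funext fun c => congrArg (HCell.mk' _ _) (InfBifunctor.curry_d _ _)
      rw [e]
      exact ih _
    · have e : (fun c : L.C 0 => InfCAT.c (HCell.mk' (L.Hom c b) (L.Hom c a) (L.post c f))) =
          fun c : L.C 0 => HCell.mk' (L.Hom c b) (L.Hom c a) (L.post c ((L.Hom b a).c f)) :=
        funext fun c => congrArg (HCell.mk' _ _) (InfBifunctor.curry_c _ _)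
      rw [e]
      exact ih _

/-- The cell `L(-, f) : L(-, b) ⟶ L(-, a)` of the presheaf ∞-category with the components
`L(c, f)`, for a cell `f` of `L(b, a)`. -/
def yoMap {a b : L.C 0} {n : ℕ} (f : (L.Hom b a).C n) :
    ((FunCat L.op InfCAT.{u}).Hom (L.yo b) (L.yo a)).C n :=
  ⟨(⟨L.yo b, L.yo a, fun c : L.C 0 => HCell.mk' (L.Hom c b) (L.Hom c a) (L.post c f),
      L.isMod_yo f⟩ : Modification L.op InfCAT.{u} n),
    FunCell.src_zero (n := n + 1) (Nat.zero_le _) _, FunCell.tgt_zero (n := n + 1) (Nat.zero_le _) _⟩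

end InfCat

/-! ### Components of cells of presheaf ∞-categories -/

/-- The value of a functor `M ⟶ ∞-CAT` at an object, as an ∞-category. -/
def InfFunctor.obj {M : InfCat.{v}} (F : InfFunctor M InfCAT.{u}) (a : M.C 0) : InfCat.{u} :=
  F.map a

/-- A cell of degree `n` of the hom ∞-category `∞-CAT(K, K')` is a functor, if `n = 0`, or a
modification. -/
def ofHom {K K' : InfCat.{u}} {n : ℕ}
    (x : (InfCAT.{u}.Hom (HCell.ob K) (HCell.ob K')).C n) : FunCell K K' n :=
  FunCell.cast ((HCell.src_mk0 (HCell.x x.1) (Nat.zero_le _)).symm.trans x.2.1)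
    ((HCell.tgt_mk0 (HCell.x x.1) (Nat.zero_le _)).symm.trans x.2.2) (HCell.x x.1)

theorem src_app_hom {M : InfCat.{v}} {M' : InfCat.{w}} {F G : InfFunctor M M'} {n : ℕ}
    (τ : ((FunCat M M').Hom F G).C n) (a : M.C 0) :
    M'.src (Nat.zero_le (n + 1)) (FunCell.app (n := n + 1) τ.1 a) = F.map a := by
  have h : FunCell.dom (n := n + 1) τ.1 = F :=
    (FunCell.src_zero (n := n + 1) (Nat.zero_le _) τ.1).symm.trans τ.2.1
  rw [FunCell.src_app, h]

theorem tgt_app_hom {M : InfCat.{v}} {M' : InfCat.{w}} {F G : InfFunctor M M'} {n : ℕ}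
    (τ : ((FunCat M M').Hom F G).C n) (a : M.C 0) :
    M'.tgt (Nat.zero_le (n + 1)) (FunCell.app (n := n + 1) τ.1 a) = G.map a := by
  have h : FunCell.cod (n := n + 1) τ.1 = G :=
    (FunCell.tgt_zero (n := n + 1) (Nat.zero_le _) τ.1).symm.trans τ.2.2
  rw [FunCell.tgt_app, h]

/-- The component at `a` of a cell of degree `n` of the hom ∞-category `∞-CAT^M (F, G)`. -/
def compAt {M : InfCat.{v}} {F G : InfFunctor M InfCAT.{u}} {n : ℕ}
    (τ : ((FunCat M InfCAT.{u}).Hom F G).C n) (a : M.C 0) :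
    FunCell (F.obj a) (G.obj a) n :=
  ofHom ⟨FunCell.app (n := n + 1) τ.1 a, src_app_hom τ a, tgt_app_hom τ a⟩

/-- The value `F(f) : F(a) ⟶ F(b)` of a presheaf at a cell `f : b ⟶ a`. -/
def presheafMap {L : InfCat.{u}} (F : InfFunctor L.op InfCAT.{u}) {a b : L.C 0} {n : ℕ}
    (f : (L.Hom b a).C n) : FunCell (F.obj a) (F.obj b) n :=
  ofHom (F.onHom (K := L.op) a b (InfCat.homOp f))

/-- A functor as a cell of degree `n`, through iterated identities. -/
def InfFunctor.cell {K : InfCat.{u}} {K' : InfCat.{v}} (F : InfFunctor K K') (n : ℕ) :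
    FunCell K K' n :=
  (FunCat K K').up (Nat.zero_le n) F

/-- The value `τ_a(e a)` at the identity of `a` of the component at `a` of a cell `τ` of
`∞-CAT^(Lᵒᵖ)(L(-, a), F)`. -/
def yonedaEval {L : InfCat.{u}} {a : L.C 0} {F : InfFunctor L.op InfCAT.{u}} {n : ℕ}
    (τ : ((FunCat L.op InfCAT.{u}).Hom (L.yo a) F).C n) : (F.obj a).C n :=
  FunCell.app (K := L.Hom a a) (K' := F.obj a) (compAt τ a) (L.idHom a)

/-! The Yoneda lemma for strict ∞-categories. Write `𝒫` for the ∞-category of presheaves on `L`.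

A presheaf `F` gives functors of two variables `L(b, a) × F(a) ⟶ F(b)`, `(k, y) ↦ F(k)(y)`
(`presheafAct`). Currying them sends a cell `y` of `F(a)` of degree `n` to a family, indexed by `b`, of
cells of degree `n` of `∞-CAT(L(b, a), F(b))`. This family is a cell of `𝒫(L(-, a), F)`
(`yonedaInv`), because `F(k * g)(y) = F(g)(F(k)(y))`, and its value at `e a` is `y`. Conversely,
naturality of a cell `τ` of `𝒫(L(-, a), F)` with respect to `k`, evaluated at `e a`, says that
`τ_b(k) = F(k)(τ_a(e a))` (`compAt_up_act`), so `τ` is the family obtained from `τ_a(e a)`. Hence the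
functor `τ ↦ τ_a(e a)` (`yonedaFunctor`) is bijective in every degree, and so it is an isomorphism
(`InfIso.ofInverse`). Naturality in `a` and `F` comes from the same formula (`yonedaEval_homMap`).

A cell of degree `n` of `∞-CAT(K, K')` consists of components and of a domain and a codomain functor,
and an identity between such cells has to be checked for all of them. If the two sides depend
functorially on parameters, the identity follows from the equality of the actions on cells of `K` of
degree `n`, for all `n` and all values of the parameters, since the parameters may be replaced by
iterated identities of their domains and codomains (`InfBifunctor.map_eq_of_act_eq`). Therefore the
constructions are set up as functors, and most identities are proved by computing actions. -/

universe t

/-! ### Actions of functors and modifications -/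

namespace FunCell

variable {K : InfCat.{u}} {K' : InfCat.{v}} {K'' : InfCat.{w}}

theorem cell_act (F : InfFunctor K K') {n : ℕ} (y : K.C n) : (F.cell n).act y = F.map y := by
  rcases Nat.eq_zero_or_pos n with rfl | hn
  · exact congrArg (fun x : FunCell K K' 0 => x.act y) (InfPrecat.up_self (funPrecat K K') _ _)
  · have hd : (F.cell n).dom = F := up_dom _ _
    have ha : (F.cell n).app (K.tgt hn.le y) = K'.up hn.le (F.map (K.tgt hn.le y)) :=
      up_app _ _ _
    rw [act_eq hn, K'.unit_left' hn _ _ _ ha, hd]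

/-- The domain functor of a cell `x` is its own action on cells of degree `m`, once `x` is cut down
to degree `0` and raised to degree `m`. So an identity between actions in all degrees, for a family
of cells closed under domains and identities, determines the domain functors. -/
theorem dom_map_eq_act {n m : ℕ} (x : FunCell K K' n) (y : K.C m) :
    x.dom.map y =
      FunCell.act ((funPrecat K K').up (Nat.zero_le m) ((funGraph K K').src (Nat.zero_le n) x)) y := by
  rw [src_zero]
  exact (cell_act x.dom y).symm

theorem cod_map_eq_act {n m : ℕ} (x : FunCell K K' n) (y : K.C m) :
    x.cod.map y =
      FunCell.act ((funPrecat K K').up (Nat.zero_le m) ((funGraph K K').tgt (Nat.zero_le n) x)) y := by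
  rw [tgt_zero]
  exact (cell_act x.cod y).symm

/-- Cells of `∞-CAT(K, K')` are determined by their action, together with the actions of their
`0`-dimensional domain and codomain. -/
theorem ext_act {n : ℕ} {x y : FunCell K K' n}
    (hs : ∀ (m : ℕ) (k : K.C m),
      FunCell.act ((funPrecat K K').up (Nat.zero_le m) ((funGraph K K').src (Nat.zero_le n) x)) k =
      FunCell.act ((funPrecat K K').up (Nat.zero_le m) ((funGraph K K').src (Nat.zero_le n) y)) k)
    (ht : ∀ (m : ℕ) (k : K.C m),
      FunCell.act ((funPrecat K K').up (Nat.zero_le m) ((funGraph K K').tgt (Nat.zero_le n) x)) k =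
      FunCell.act ((funPrecat K K').up (Nat.zero_le m) ((funGraph K K').tgt (Nat.zero_le n) y)) k)
    (h : ∀ k : K.C n, x.act k = y.act k) : x = y := by
  refine ext' ?_ ?_ fun a => ?_
  · refine InfFunctor.ext ?_
    funext m k
    rw [dom_map_eq_act, dom_map_eq_act, hs]
  · refine InfFunctor.ext ?_
    funext m k
    rw [cod_map_eq_act, cod_map_eq_act, ht]
  · rw [← act_app, ← act_app, h]

/-- Evaluation at an object, as a functor `∞-CAT(K, K') ⟶ K'`. -/
def evalFunctor (a : K.C 0) : InfFunctor (FunCat K K') K' where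
  map x := app x a
  map_d x := app_d x a
  map_c x := app_c x a
  map_e x := e_app x a
  map_comp hi x y h _ := comp_app hi x y h a

/-- Horizontal composition `∞-CAT(K', K'') × ∞-CAT(K, K') ⟶ ∞-CAT(K, K'')`. -/
def hcompBifunctor (K : InfCat.{u}) (K' : InfCat.{v}) (K'' : InfCat.{w}) :
    InfBifunctor (FunCat K' K'') (FunCat K K') (FunCat K K'') where
  map x y := hcomp x y
  map_d x y := (hcomp_d x y).symm
  map_c x y := (hcomp_c x y).symm
  map_e x y := (hcomp_e x y).symm
  map_comp hi x x' y y' h₁ h₂ h₃ := hcomp_comp hi x x' y y' h₁ h₂ h₃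

end FunCell

/-! ### Operations on functors of two variables -/

namespace InfBifunctor

variable {A : InfCat.{u}} {B : InfCat.{v}} {D : InfCat.{w}}

/-- The functor `(x, y) ↦ μ(F x, G y)`. -/
def precomp {A' : InfCat.{z}} {B' : InfCat.{t}} (μ : InfBifunctor A B D)
    (F : InfFunctor A' A) (G : InfFunctor B' B) : InfBifunctor A' B' D where
  map x y := μ.map (F.map x) (G.map y)
  map_d x y := by rw [F.map_d, G.map_d, μ.map_d]
  map_c x y := by rw [F.map_c, G.map_c, μ.map_c]
  map_e x y := by rw [F.map_e, G.map_e, μ.map_e]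
  map_comp hi f f' g g' h₁ h₂ h₃ := by
    rw [F.map_comp hi f f' h₁ (F.glue h₁), G.map_comp hi g g' h₂ (G.glue h₂), μ.map_comp]

/-- The functor `(x, y) ↦ T(μ(x, y))`. -/
def postcomp {D' : InfCat.{z}} (μ : InfBifunctor A B D) (T : InfFunctor D D') :
    InfBifunctor A B D' where
  map x y := T.map (μ.map x y)
  map_d x y := by rw [μ.map_d, T.map_d]
  map_c x y := by rw [μ.map_c, T.map_c]
  map_e x y := by rw [μ.map_e, T.map_e]
  map_comp hi f f' g g' h₁ h₂ h₃ := by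
    have h : D.src hi.le (μ.map f g) = D.tgt hi.le (μ.map f' g') := by
      rw [← μ.map_src, ← μ.map_tgt, h₁, h₂]
    rw [μ.map_comp hi f f' g g' h₁ h₂ h, T.map_comp]

/-- Currying, as a functor `B ⟶ ∞-CAT(A, D)`. -/
def curryFunctor (μ : InfBifunctor A B D) : InfFunctor B (FunCat A D) where
  map y := μ.curry y
  map_d y := (μ.curry_d y).symm
  map_c y := (μ.curry_c y).symm
  map_e y := (μ.curry_e y).symm
  map_comp hi x y h h' := (μ.curry_comp hi x y h h').symm

/-- Two functors `A × B ⟶ ∞-CAT(K, K')` agree if their values act in the same way on all cells of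
`K`. The action of `μ(x, y)` on cells of its own degree alone does not determine its domain and
codomain functors; they are recovered from the hypothesis at the pairs of iterated identities on
`0`-dimensional domains and codomains. -/
theorem map_eq_of_act_eq {K : InfCat.{w}} {K' : InfCat.{z}}
    (μ ν : InfBifunctor A B (FunCat K K'))
    (H : ∀ (n : ℕ) (x : A.C n) (y : B.C n) (k : K.C n),
      FunCell.act (μ.map x y) k = FunCell.act (ν.map x y) k)
    {n : ℕ} (x : A.C n) (y : B.C n) : μ.map x y = ν.map x y := by
  refine FunCell.ext_act (fun m k => ?_) (fun m k => ?_) (H n x y)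
  · rw [← μ.map_src, ← μ.map_up, ← ν.map_src, ← ν.map_up, H]
  · rw [← μ.map_tgt, ← μ.map_up, ← ν.map_tgt, ← ν.map_up, H]

end InfBifunctor

/-- The analogue of `InfBifunctor.map_eq_of_act_eq` for functors of one variable. -/
theorem InfFunctor.map_eq_of_act_eq {A : InfCat.{u}} {K : InfCat.{w}} {K' : InfCat.{z}}
    (S T : InfFunctor A (FunCat K K'))
    (H : ∀ (n : ℕ) (x : A.C n) (k : K.C n), FunCell.act (S.map x) k = FunCell.act (T.map x) k)
    {n : ℕ} (x : A.C n) : S.map x = T.map x := by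
  refine FunCell.ext_act (fun m k => ?_) (fun m k => ?_) (H n x)
  · rw [← S.map_src, ← S.map_up, ← T.map_src, ← T.map_up, H]
  · rw [← S.map_tgt, ← S.map_up, ← T.map_tgt, ← T.map_up, H]

/-! ### Isomorphisms and hom ∞-categories -/

/-- A functor which is bijective on cells of every degree is an isomorphism: its inverse maps are
automatically functorial. -/
def InfIso.ofInverse {K : InfCat.{u}} {K' : InfCat.{v}} (F : InfFunctor K K')
    (g : ∀ {n : ℕ}, K'.C n → K.C n) (gF : ∀ {n : ℕ} (x : K.C n), g (F.map x) = x)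
    (Fg : ∀ {n : ℕ} (y : K'.C n), F.map (g y) = y) : InfIso K K' where
  hom := F
  inv :=
    { map := g
      map_d := fun x => by rw [← gF (K.d (g x)), F.map_d, Fg]
      map_c := fun x => by rw [← gF (K.c (g x)), F.map_c, Fg]
      map_e := fun x => by rw [← gF (K.e (g x)), F.map_e, Fg]
      map_comp := fun hi x y h h' => by
        rw [← gF (K.comp _ hi (g x) (g y) h'), F.map_comp hi _ _ h' (F.glue h'),
          K'.comp_congr (Fg x) (Fg y)] }
  inv_hom := gF
  hom_inv := Fg

/-- The restriction of a functor to hom ∞-categories, as a functor. -/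
def InfFunctor.onHomFunctor {K : InfCat.{u}} {K' : InfCat.{v}} (F : InfFunctor K K')
    (a b : K.C 0) : InfFunctor (K.Hom a b) (K'.Hom (F.map a) (F.map b)) where
  map f := F.onHom a b f
  map_d f := Subtype.ext (F.map_d f.1)
  map_c f := Subtype.ext (F.map_c f.1)
  map_e f := Subtype.ext (F.map_e f.1)
  map_comp hi f g h h' := Subtype.ext (F.map_comp (Nat.succ_lt_succ hi) f.1 g.1 _ _)

/-- The passage from `L(b, a)` to `Lᵒᵖ(a, b)`, which is the identity on cells, as a functor. -/
def InfCat.homOpFunctor (L : InfCat.{u}) (a b : L.C 0) :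
    InfFunctor (L.Hom b a) (L.op.Hom a b) where
  map f := homOp f
  map_d _ := rfl
  map_c _ := rfl
  map_e _ := rfl
  map_comp _ _ _ _ _ := rfl

namespace HCell

theorem mk'_injective {n : ℕ} {K K' : InfCat.{u}} {x y : FunCell K K' n}
    (h : mk' K K' x = mk' K K' y) : x = y := by
  obtain ⟨_, _, e⟩ := mk'_inj h
  exact e

theorem glue_mk' {n : ℕ} {K K' K'' : InfCat.{u}} (x : FunCell K' K'' n) (y : FunCell K K' n) :
    catGraph.src (Nat.zero_le (n + 1)) (mk' K' K'' x) =
      catGraph.tgt (Nat.zero_le (n + 1)) (mk' K K' y) :=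
  (src_mk0 x _).trans (tgt_mk0 y _).symm

/-- A cell `x` of a hom ∞-category of `∞-CAT` is recovered from `ofHom x`; with
`HCell.mk'_injective` this reduces identities between values of `ofHom`, which involve transports,
to identities in `∞-CAT`. -/
theorem mk'_ofHom {n : ℕ} {K K' : InfCat.{u}} (x : (InfCAT.{u}.Hom (ob K) (ob K')).C n) :
    mk' K K' (ofHom x) = x.1 := by
  obtain ⟨x, h₁, h₂⟩ := x
  obtain ⟨J, J', x, rfl⟩ := ex x
  obtain rfl : J = K := (src_mk0 x (Nat.zero_le _)).symm.trans h₁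
  obtain rfl : J' = K' := (tgt_mk0 x (Nat.zero_le _)).symm.trans h₂
  rfl

end HCell

open HCell in
/-- The identification of the hom ∞-category of `∞-CAT` between `K` and `K'` with the functor
∞-category, as a functor. -/
def ofHomFunctor (K K' : InfCat.{u}) :
    InfFunctor (InfCAT.{u}.Hom (HCell.ob K) (HCell.ob K')) (FunCat K K') where
  map x := ofHom x
  map_d x := mk'_injective ((mk'_ofHom _).trans (congrArg InfCAT.d (mk'_ofHom x).symm))
  map_c x := mk'_injective ((mk'_ofHom _).trans (congrArg InfCAT.c (mk'_ofHom x).symm))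
  map_e x := mk'_injective ((mk'_ofHom _).trans (congrArg InfCAT.e (mk'_ofHom x).symm))
  map_comp hi x y h h' := mk'_injective ((mk'_ofHom _).trans
    ((InfCAT.comp_congr (hi := Nat.succ_lt_succ hi) (mk'_ofHom x).symm (mk'_ofHom y).symm
      (InfCat.homGraph_glue _ h)).trans rfl))

/-! ### Components of modifications -/

/-- The component at `a` of transformations and modifications `F ⟶ G`, as a functor. -/
def homEvalFunctor {M : InfCat.{v}} {M' : InfCat.{w}} (F G : InfFunctor M M') (a : M.C 0) :
    InfFunctor ((FunCat M M').Hom F G) (M'.Hom (F.map a) (G.map a)) where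
  map {n} τ := ⟨FunCell.app (n := n + 1) τ.1 a, src_app_hom τ a, tgt_app_hom τ a⟩
  map_d τ := Subtype.ext (FunCell.app_d τ.1 a)
  map_c τ := Subtype.ext (FunCell.app_c τ.1 a)
  map_e {n} τ := Subtype.ext (FunCell.e_app (n := n + 1) τ.1 a)
  map_comp hi τ σ h _ := Subtype.ext (FunCell.comp_app (Nat.succ_lt_succ hi) τ.1 σ.1
    (InfCat.homGraph_glue _ h) a)

/-- `compAt` as a functor: the component at `a` of cells of `∞-CAT^M (F, G)`. -/
def compAtFunctor {M : InfCat.{v}} (F G : InfFunctor M InfCAT.{u}) (a : M.C 0) :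
    InfFunctor ((FunCat M InfCAT.{u}).Hom F G) (FunCat (F.obj a) (G.obj a)) :=
  (ofHomFunctor (F.obj a) (G.obj a)).comp (homEvalFunctor F G a)

section

variable {M : InfCat.{v}} {F G H : InfFunctor M InfCAT.{u}}

theorem mk'_compAt {n : ℕ} (τ : ((FunCat M InfCAT.{u}).Hom F G).C n) (a : M.C 0) :
    HCell.mk' (F.obj a) (G.obj a) (compAt τ a) = FunCell.app (n := n + 1) τ.1 a :=
  HCell.mk'_ofHom _

theorem hom_ext_compAt {n : ℕ} {τ σ : ((FunCat M InfCAT.{u}).Hom F G).C n}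
    (h : ∀ a, compAt τ a = compAt σ a) : τ = σ := by
  refine Subtype.ext (FunCell.ext' (n := n + 1) ?_ ?_ fun a => ?_)
  · exact (FunCell.src_zero (n := n + 1) (Nat.zero_le _) τ.1).symm.trans
      (τ.2.1.trans (σ.2.1.symm.trans (FunCell.src_zero (n := n + 1) (Nat.zero_le _) σ.1)))
  · exact (FunCell.tgt_zero (n := n + 1) (Nat.zero_le _) τ.1).symm.trans
      (τ.2.2.trans (σ.2.2.symm.trans (FunCell.tgt_zero (n := n + 1) (Nat.zero_le _) σ.1)))
  · rw [← mk'_compAt, ← mk'_compAt, h]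

theorem compAt_homComp {n : ℕ} (σ : ((FunCat M InfCAT.{u}).Hom G H).C n)
    (τ : ((FunCat M InfCAT.{u}).Hom F G).C n) (a : M.C 0) :
    compAt (((FunCat M InfCAT.{u}).homComp F G H).map σ τ) a =
      (compAt σ a).hcomp (compAt τ a) := by
  refine HCell.mk'_injective ((mk'_compAt _ a).trans ?_)
  refine (FunCell.comp_app (Nat.succ_pos n) σ.1 τ.1 (σ.2.1.trans τ.2.2.symm) a).trans ?_
  exact Eq.symm (InfCAT.comp_congr (hi := Nat.succ_pos n) (mk'_compAt σ a) (mk'_compAt τ a)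
    (HCell.glue_mk' _ _))

/-- The naturality condition on a modification of functors `M ⟶ ∞-CAT`, as an identity between
horizontal composites of functors and modifications. -/
theorem compAt_natural {n m : ℕ} (τ : ((FunCat M InfCAT.{u}).Hom F G).C n) (h : n ≤ m)
    {a b : M.C 0} (f : (M.Hom a b).C m) :
    FunCell.hcomp ((FunCat (F.obj b) (G.obj b)).up h (compAt τ b)) (ofHom (F.onHom a b f)) =
      FunCell.hcomp (ofHom (G.onHom a b f)) ((FunCat (F.obj a) (G.obj a)).up h (compAt τ a)) := by
  have e : ∀ c : M.C 0, HCell.mk' (F.obj c) (G.obj c)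
      ((FunCat (F.obj c) (G.obj c)).up h (compAt τ c)) =
      InfCAT.up (Nat.succ_le_succ h) (FunCell.app (n := n + 1) τ.1 c) := fun c =>
    (HCell.up_mk' h _).symm.trans (congrArg _ (mk'_compAt τ c))
  have eF : HCell.mk' (F.obj a) (F.obj b) (ofHom (F.onHom a b f)) = F.map f.1 :=
    HCell.mk'_ofHom (F.onHom a b f)
  have eG : HCell.mk' (G.obj a) (G.obj b) (ofHom (G.onHom a b f)) = G.map f.1 :=
    HCell.mk'_ofHom (G.onHom a b f)
  apply HCell.mk'_injective
  have hd : FunCell.dom (n := n + 1) τ.1 = F :=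
    (FunCell.src_zero (n := n + 1) (Nat.zero_le _) τ.1).symm.trans τ.2.1
  have hc : FunCell.cod (n := n + 1) τ.1 = G :=
    (FunCell.tgt_zero (n := n + 1) (Nat.zero_le _) τ.1).symm.trans τ.2.2
  have nat : IsNatural F G n (FunCell.app (n := n + 1) τ.1) := by
    have := (Modification.isMod (n := n) τ.1).natural
    rw [show Modification.dom (n := n) τ.1 = F from hd,
      show Modification.cod (n := n) τ.1 = G from hc] at this
    exact this
  obtain ⟨f, rfl, rfl⟩ := f
  refine (InfCAT.comp_congr (hi := Nat.succ_pos m) (e _) eF (HCell.glue_mk' _ _)).trans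
    (Eq.trans ?_ (InfCAT.comp_congr (hi := Nat.succ_pos m) eG (e _) (HCell.glue_mk' _ _)).symm)
  exact nat m h f _ _

end

/-- The action of functors and modifications on cells, as a functor `∞-CAT(K, K') × K ⟶ K'`. -/
def FunCell.actBifunctor (K : InfCat.{u}) (K' : InfCat.{v}) : InfBifunctor (FunCat K K') K K' where
  map x y := FunCell.act x y
  map_d x y := (FunCell.d_act x y).symm
  map_c x y := (FunCell.c_act x y).symm
  map_e x y := (FunCell.e_act x y).symm
  map_comp hi x x' y y' h₁ h₂ h₃ := FunCell.act_comp hi x x' y y' h₁ h₂ h₃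

/-! ### Presheaves and their values on cells -/

section

variable {L : InfCat.{u}}

/-- The action of a presheaf on cells, as a functor `L(b, a) ⟶ ∞-CAT(F(a), F(b))`. -/
def presheafMapFunctor (F : InfFunctor L.op InfCAT.{u}) (a b : L.C 0) :
    InfFunctor (L.Hom b a) (FunCat (F.obj a) (F.obj b)) :=
  (ofHomFunctor (F.obj a) (F.obj b)).comp
    ((F.onHomFunctor (K := L.op) a b).comp (L.homOpFunctor a b))

theorem mk'_presheafMap (F : InfFunctor L.op InfCAT.{u}) {a b : L.C 0} {n : ℕ}
    (f : (L.Hom b a).C n) :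
    HCell.mk' (F.obj a) (F.obj b) (presheafMap F f) = F.map (K := L.op) f.1 :=
  HCell.mk'_ofHom _

theorem presheafMap_comp (F : InfFunctor L.op InfCAT.{u}) {a b c : L.C 0} {n : ℕ}
    (f : (L.Hom b a).C n) (g : (L.Hom c b).C n) :
    presheafMap F ((L.homComp c b a).map f g) = (presheafMap F g).hcomp (presheafMap F f) := by
  refine HCell.mk'_injective ((mk'_presheafMap F _).trans ?_)
  have h : L.op.src (Nat.zero_le (n + 1)) g.1 = L.op.tgt (Nat.zero_le (n + 1)) f.1 :=
    (L.opGraph_src0 (Nat.succ_pos n) g.1).trans (g.2.2.trans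
      (f.2.1.symm.trans (L.opGraph_tgt0 (Nat.succ_pos n) f.1).symm))
  refine (F.map_comp (K := L.op) (Nat.succ_pos n) g.1 f.1 h (F.glue h)).trans ?_
  exact Eq.symm (InfCAT.comp_congr (hi := Nat.succ_pos n) (mk'_presheafMap F g)
    (mk'_presheafMap F f) (HCell.glue_mk' _ _))

theorem presheafMap_idHom (F : InfFunctor L.op InfCAT.{u}) (a : L.C 0) :
    presheafMap F (L.idHom a) = FunCell.idCell (F.obj a) :=
  HCell.mk'_injective ((mk'_presheafMap F _).trans (F.map_e (K := L.op) a))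

theorem presheafMap_compAt {F G : InfFunctor L.op InfCAT.{u}} {n m : ℕ}
    (τ : ((FunCat L.op InfCAT.{u}).Hom F G).C n) (h : n ≤ m) {a b : L.C 0} (f : (L.Hom b a).C m) :
    FunCell.hcomp ((FunCat (F.obj b) (G.obj b)).up h (compAt τ b)) (presheafMap F f) =
      FunCell.hcomp (presheafMap G f) ((FunCat (F.obj a) (G.obj a)).up h (compAt τ a)) :=
  compAt_natural τ h (InfCat.homOp f)

theorem presheafMap_yo (a : L.C 0) {b c : L.C 0} {n : ℕ} (f : (L.Hom c b).C n) :
    presheafMap (L.yo a) f = L.pre a f :=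
  HCell.mk'_injective ((mk'_presheafMap (L.yo a) f).trans (L.yoCell_eq a f))

theorem compAt_yoMap {a b : L.C 0} {n : ℕ} (f : (L.Hom b a).C n) (c : L.C 0) :
    compAt (L.yoMap f) c = L.post c f :=
  HCell.mk'_injective (mk'_compAt (L.yoMap f) c)

/-- Precomposition `f ↦ L(f, c)`, as a functor of `f`. -/
def InfCat.preFunctor (L : InfCat.{u}) (a b c : L.C 0) :
    InfFunctor (L.Hom a b) (FunCat (L.Hom b c) (L.Hom a c)) :=
  (L.homComp a b c).curryFunctor

/-- Postcomposition `f ↦ L(a, f)`, as a functor of `f`. -/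
def InfCat.postFunctor (L : InfCat.{u}) (a b c : L.C 0) :
    InfFunctor (L.Hom b c) (FunCat (L.Hom a b) (L.Hom a c)) :=
  (L.homComp a b c).flip.curryFunctor

/-- The Yoneda embedding `f ↦ L(-, f)`, as a functor on hom ∞-categories. -/
def InfCat.yoMapFunctor (L : InfCat.{u}) (a b : L.C 0) :
    InfFunctor (L.Hom b a) ((FunCat L.op InfCAT.{u}).Hom (L.yo b) (L.yo a)) where
  map f := L.yoMap f
  map_d f := hom_ext_compAt fun (c : L.C 0) => (compAt_yoMap (L := L) _ c).trans
    (((L.postFunctor c b a).map_d f).trans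
      ((congrArg (funGraph _ _).d (compAt_yoMap f c).symm).trans
        ((compAtFunctor (M := L.op) _ _ c).map_d (L.yoMap f)).symm))
  map_c f := hom_ext_compAt fun (c : L.C 0) => (compAt_yoMap (L := L) _ c).trans
    (((L.postFunctor c b a).map_c f).trans
      ((congrArg (funGraph _ _).c (compAt_yoMap f c).symm).trans
        ((compAtFunctor (M := L.op) _ _ c).map_c (L.yoMap f)).symm))
  map_e f := hom_ext_compAt fun (c : L.C 0) => (compAt_yoMap (L := L) _ c).trans
    (((L.postFunctor c b a).map_e f).trans
      ((congrArg FunCell.e (compAt_yoMap f c).symm).trans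
        ((compAtFunctor (M := L.op) _ _ c).map_e (L.yoMap f)).symm))
  map_comp hi f g h h' := hom_ext_compAt fun (c : L.C 0) => (compAt_yoMap (L := L) _ c).trans
    (((L.postFunctor c b a).map_comp hi f g h ((L.postFunctor c b a).glue h)).trans
      (((FunCat _ _).comp_congr (hi := hi) (compAt_yoMap f c).symm (compAt_yoMap g c).symm _).trans
        ((compAtFunctor (M := L.op) _ _ c).map_comp hi (L.yoMap f) (L.yoMap g) h'
          ((compAtFunctor (M := L.op) _ _ c).glue h')).symm))

/-! ### The Yoneda isomorphism -/

/-- The functor `L(b, a) × F(a) ⟶ F(b)`, `(k, y) ↦ F(k)(y)`. -/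
def presheafAct (F : InfFunctor L.op InfCAT.{u}) (a b : L.C 0) :
    InfBifunctor (L.Hom b a) (F.obj a) (F.obj b) :=
  (FunCell.actBifunctor (F.obj a) (F.obj b)).precomp (presheafMapFunctor F a b) (InfFunctor.id _)

/-- Evaluation `τ ↦ τ_a(e a)` at the identity of `a`, as a functor. -/
def yonedaFunctor (a : L.C 0) (F : InfFunctor L.op InfCAT.{u}) :
    InfFunctor ((FunCat L.op InfCAT.{u}).Hom (L.yo a) F) (F.obj a) :=
  (FunCell.evalFunctor (K := L.Hom a a) (K' := F.obj a) (L.idHom a)).comp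
    (compAtFunctor (L.yo a) F a)

theorem pre_app_idHom {a b : L.C 0} {n : ℕ} (f : (L.Hom b a).C n) :
    (L.pre a f).app (L.idHom a) = f := by
  refine ((L.homComp b a a).curry_app f (L.idHom a)).trans (Subtype.ext ?_)
  refine L.unit_left' (Nat.succ_pos n) _ _ a ?_ _
  exact (L.homPrecat_up a a _ _).trans (L.up_e _ _ _)

theorem post_app_idHom {a b : L.C 0} {n : ℕ} (f : (L.Hom b a).C n) :
    (L.post b f).app (L.idHom b) = f := by
  refine ((L.homComp b b a).flip.curry_app f (L.idHom b)).trans (Subtype.ext ?_)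
  refine L.unit_right' (Nat.succ_pos n) _ _ b ?_ _
  exact (L.homPrecat_up b b _ _).trans (L.up_e _ _ _)

/-- The components of a cell `τ` of degree `n` of `𝒫(L(-, a), F)` are determined by the value
`y = τ_a(e a)`: on cells `f` of degree `m ≥ n` they are `f ↦ F(f)(y)`, by naturality of `τ` with
respect to `f`, evaluated at `e a`. -/
theorem compAt_up_act {F : InfFunctor L.op InfCAT.{u}} {a b : L.C 0} {n m : ℕ} (h : n ≤ m)
    (τ : ((FunCat L.op InfCAT.{u}).Hom (L.yo a) F).C n) (f : (L.Hom b a).C m) :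
    FunCell.act ((FunCat (L.Hom b a) (F.obj b)).up h (compAt τ b)) f =
      (presheafMap F f).act ((F.obj a).up h (yonedaEval τ)) := by
  have e := congrArg (fun x : FunCell (L.Hom a a) (F.obj b) m => x.app (L.idHom a))
    ((congrArg (FunCell.hcomp ((FunCat (L.Hom b a) (F.obj b)).up h (compAt τ b)))
      (presheafMap_yo a f).symm).trans (presheafMap_compAt τ h f))
  refine Eq.trans ?_ (e.trans ?_)
  · exact (congrArg _ (pre_app_idHom f).symm).trans (FunCell.hcomp_app _ _ _).symm
  · exact (FunCell.hcomp_app _ _ _).trans (congrArg _ (FunCell.up_app h _ _))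

theorem compAt_act {F : InfFunctor L.op InfCAT.{u}} {a b : L.C 0} {n : ℕ}
    (τ : ((FunCat L.op InfCAT.{u}).Hom (L.yo a) F).C n) (f : (L.Hom b a).C n) :
    FunCell.act (K := L.Hom b a) (K' := F.obj b) (compAt τ b) f =
      (presheafMap F f).act (yonedaEval τ) := by
  refine Eq.trans ?_ ((compAt_up_act le_rfl τ f).trans ?_)
  · exact congrArg (fun x => FunCell.act x f)
      ((FunCat (L.Hom b a) (F.obj b)).up_self le_rfl (compAt τ b)).symm
  · exact congrArg _ ((F.obj a).up_self le_rfl _)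

/-- Naturality of `b ↦ (k ↦ F(k)(y))` with respect to `g`: in terms of actions it says that
`F(k * g)(y) = F(g)(F(k)(y))`. -/
theorem curry_presheafAct_hcomp_pre (F : InfFunctor L.op InfCAT.{u}) (a : L.C 0) {s t : L.C 0}
    {n : ℕ} (g : (L.Hom s t).C n) (y : (F.obj a).C n) :
    FunCell.hcomp ((presheafAct F a s).curry y) (L.pre a g) =
      (presheafMap F g).hcomp ((presheafAct F a t).curry y) := by
  refine InfBifunctor.map_eq_of_act_eq
    ((FunCell.hcompBifunctor (L.Hom t a) (L.Hom s a) (F.obj s)).flip.precomp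
      (L.preFunctor s t a) (presheafAct F a s).curryFunctor)
    ((FunCell.hcompBifunctor (L.Hom t a) (F.obj t) (F.obj s)).precomp
      (presheafMapFunctor F t s) (presheafAct F a t).curryFunctor) ?_ g y
  intro n g y k
  refine (FunCell.hcomp_act _ _ _).trans (Eq.trans ?_ (FunCell.hcomp_act _ _ _).symm)
  refine ((presheafAct F a s).curry_act y _).trans
    (Eq.trans ?_ (congrArg _ ((presheafAct F a t).curry_act y k)).symm)
  refine Eq.trans ?_ (FunCell.hcomp_act (presheafMap F g) (presheafMap F k) y)
  refine congrArg (fun x => FunCell.act x y) ?_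
  exact (congrArg (presheafMap F) ((L.homComp s t a).curry_act g k)).trans
    (presheafMap_comp F k g)


theorem isNatural_curry_presheafAct (F : InfFunctor L.op InfCAT.{u}) (a : L.C 0) {n : ℕ}
    (y : (F.obj a).C n) :
    IsNatural (L.yo a) F n
      (fun b : L.C 0 => HCell.mk' (L.Hom b a) (F.obj b) ((presheafAct F a b).curry y)) := by
  intro m hm g h₁ h₂
  have es : L.op.src (Nat.zero_le (m + 1)) g = L.tgt (Nat.zero_le _) g :=
    L.opGraph_src0 (Nat.succ_pos m) g
  have et : L.op.tgt (Nat.zero_le (m + 1)) g = L.src (Nat.zero_le _) g :=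
    L.opGraph_tgt0 (Nat.succ_pos m) g
  have e : ∀ c d : L.C 0, c = d → InfCAT.up (Nat.succ_le_succ hm)
      (HCell.mk' (L.Hom c a) (F.obj c) ((presheafAct F a c).curry y)) =
      HCell.mk' (L.Hom d a) (F.obj d) ((presheafAct F a d).curry ((F.obj a).up hm y)) := by
    rintro c _ rfl
    exact (HCell.up_mk' hm _).trans (congrArg (HCell.mk' _ _) (InfBifunctor.curry_up _ _ _))
  have eg := (mk'_presheafMap F (a := L.tgt (Nat.zero_le _) g) (b := L.src (Nat.zero_le _) g)
    ⟨g, rfl, rfl⟩).symm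
  refine (InfCAT.comp_congr (e _ _ et) rfl h₁).trans
    (Eq.trans ?_ (InfCAT.comp_congr eg (e _ _ es) h₂).symm)
  exact congrArg (HCell.mk' _ _) (curry_presheafAct_hcomp_pre F a ⟨g, rfl, rfl⟩ _)

theorem isMod_curry_presheafAct (F : InfFunctor L.op InfCAT.{u}) (a : L.C 0) {n : ℕ}
    (y : (F.obj a).C n) :
    IsModification (L.yo a) F n
      (fun b : L.C 0 => HCell.mk' (L.Hom b a) (F.obj b) ((presheafAct F a b).curry y)) := by
  induction n with
  | zero => exact ⟨fun b => ⟨rfl, rfl⟩, isNatural_curry_presheafAct F a y⟩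
  | succ n ih =>
    refine ⟨?_, ?_, isNatural_curry_presheafAct F a y⟩
    · have e : (fun b : L.C 0 => InfCAT.d
            (HCell.mk' (L.Hom b a) (F.obj b) ((presheafAct F a b).curry y))) =
          fun b : L.C 0 =>
            HCell.mk' (L.Hom b a) (F.obj b) ((presheafAct F a b).curry ((F.obj a).d y)) :=
        funext fun b => congrArg (HCell.mk' _ _) (InfBifunctor.curry_d _ _)
      rw [e]
      exact ih _
    · have e : (fun b : L.C 0 => InfCAT.c
            (HCell.mk' (L.Hom b a) (F.obj b) ((presheafAct F a b).curry y))) =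
          fun b : L.C 0 =>
            HCell.mk' (L.Hom b a) (F.obj b) ((presheafAct F a b).curry ((F.obj a).c y)) :=
        funext fun b => congrArg (HCell.mk' _ _) (InfBifunctor.curry_c _ _)
      rw [e]
      exact ih _

/-- The cell of `𝒫(L(-, a), F)` with components `k ↦ F(k)(y)`, for a cell `y` of `F(a)`. -/
def yonedaInv (F : InfFunctor L.op InfCAT.{u}) (a : L.C 0) {n : ℕ} (y : (F.obj a).C n) :
    ((FunCat L.op InfCAT.{u}).Hom (L.yo a) F).C n :=
  ⟨(⟨L.yo a, F,
      fun b : L.C 0 => HCell.mk' (L.Hom b a) (F.obj b) ((presheafAct F a b).curry y),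
      isMod_curry_presheafAct F a y⟩ : Modification L.op InfCAT.{u} n),
    FunCell.src_zero (n := n + 1) (Nat.zero_le _) _,
    FunCell.tgt_zero (n := n + 1) (Nat.zero_le _) _⟩

theorem compAt_yonedaInv (F : InfFunctor L.op InfCAT.{u}) (a b : L.C 0) {n : ℕ}
    (y : (F.obj a).C n) : compAt (yonedaInv F a y) b = (presheafAct F a b).curry y :=
  HCell.mk'_injective (mk'_compAt (yonedaInv F a y) b)

theorem yonedaEval_yonedaInv (F : InfFunctor L.op InfCAT.{u}) (a : L.C 0) {n : ℕ}
    (y : (F.obj a).C n) : yonedaEval (yonedaInv F a y) = y := by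
  refine (congrArg (fun x : FunCell (L.Hom a a) (F.obj a) n => x.app (L.idHom a))
    (compAt_yonedaInv F a a y)).trans (((presheafAct F a a).curry_app y (L.idHom a)).trans ?_)
  -- `F` sends the iterated identities of `a` to those of the identity functor of `F(a)`.
  have e : (presheafMapFunctor F a a).map ((L.Hom a a).up (Nat.zero_le n) (L.idHom a)) =
      (InfFunctor.id (F.obj a)).cell n :=
    ((presheafMapFunctor F a a).map_up (Nat.zero_le n) (L.idHom a)).trans
      (congrArg ((FunCat (F.obj a) (F.obj a)).up (Nat.zero_le n)) (presheafMap_idHom F a))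
  exact (congrArg (fun x => FunCell.act x y) e).trans (FunCell.cell_act _ y)

theorem yonedaInv_yonedaEval {F : InfFunctor L.op InfCAT.{u}} {a : L.C 0} {n : ℕ}
    (τ : ((FunCat L.op InfCAT.{u}).Hom (L.yo a) F).C n) : yonedaInv F a (yonedaEval τ) = τ := by
  refine hom_ext_compAt fun b : L.C 0 => (compAt_yonedaInv F a b _).trans ?_
  refine InfFunctor.map_eq_of_act_eq (K := L.Hom b a)
    ((presheafAct F a b).curryFunctor.comp (yonedaFunctor a F))
    (compAtFunctor (L.yo a) F b) (fun n τ k => ?_) τ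
  exact ((presheafAct F a b).curry_act _ k).trans (compAt_act τ k).symm

/-- The isomorphism `𝒫(L(-, a), F) ≅ F(a)`. -/
def yonedaIso (a : L.C 0) (F : InfFunctor L.op InfCAT.{u}) :
    InfIso ((FunCat L.op InfCAT.{u}).Hom (L.yo a) F) (F.obj a) :=
  InfIso.ofInverse (yonedaFunctor a F) (fun y => yonedaInv F a y)
    (fun τ => yonedaInv_yonedaEval τ) (fun y => yonedaEval_yonedaInv F a y)

/-- The naturality square of the Yoneda isomorphism, evaluated at a cell `τ` of the same degree as
`f` and `α`: both sides are `α_b(F(f)(τ_a(e a)))`. -/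
theorem yonedaEval_homMap {a b : L.C 0} {F G : InfFunctor L.op InfCAT.{u}} {n : ℕ}
    (f : (L.Hom b a).C n) (α : ((FunCat L.op InfCAT.{u}).Hom F G).C n)
    (τ : ((FunCat L.op InfCAT.{u}).Hom (L.yo a) F).C n) :
    yonedaEval (FunCell.act ((FunCat L.op InfCAT.{u}).homMap (L.yoMap f) α) τ) =
      (compAt α b).act ((presheafMap F f).act (yonedaEval τ)) := by
  have e : FunCell.act ((FunCat L.op InfCAT.{u}).homMap (L.yoMap f) α) τ =
      ((FunCat L.op InfCAT.{u}).homComp (L.yo b) F G).map α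
        (((FunCat L.op InfCAT.{u}).homComp (L.yo b) (L.yo a) F).map τ (L.yoMap f)) :=
    (FunCell.hcomp_act _ _ _).trans ((InfBifunctor.curry_act _ _ _).trans
      (congrArg (((FunCat L.op InfCAT.{u}).homComp (L.yo b) F G).map α)
        (InfBifunctor.curry_act _ _ _)))
  have e' : compAt (FunCell.act ((FunCat L.op InfCAT.{u}).homMap (L.yoMap f) α) τ) b =
      (compAt α b).hcomp ((compAt τ b).hcomp (L.post b f)) :=
    (congrArg (fun σ => compAt (M := L.op) σ b) e).trans ((compAt_homComp (M := L.op) _ _ b).trans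
      (congrArg (FunCell.hcomp (compAt α b)) ((compAt_homComp (M := L.op) τ (L.yoMap f) b).trans
        (congrArg (FunCell.hcomp (compAt τ b)) (compAt_yoMap f b)))))
  refine (congrArg (fun x : FunCell (L.Hom b b) (G.obj b) n => x.app (L.idHom b)) e').trans ?_
  refine (FunCell.hcomp_app _ _ _).trans (congrArg _ ?_)
  refine (FunCell.hcomp_app _ _ _).trans ((congrArg _ (post_app_idHom f)).trans ?_)
  exact compAt_act τ f

theorem yoneda_natural (a b : L.C 0) (F G : InfFunctor L.op InfCAT.{u}) {n : ℕ}
    (f : (L.Hom b a).C n) (α : ((FunCat L.op InfCAT.{u}).Hom F G).C n) :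
    ((yonedaFunctor b G).cell n).hcomp ((FunCat L.op InfCAT.{u}).homMap (L.yoMap f) α) =
      ((compAt α b).hcomp (presheafMap F f)).hcomp ((yonedaFunctor a F).cell n) := by
  let P := FunCat L.op InfCAT.{u}
  -- Both sides are functorial in `(α, f)`, so it suffices to compare actions on cells `τ`.
  refine InfBifunctor.map_eq_of_act_eq
    (((FunCell.hcompBifunctor (P.Hom (L.yo a) F) (P.Hom (L.yo b) F) (P.Hom (L.yo b) G)).precomp
      (P.postFunctor (L.yo b) F G)
      ((P.preFunctor (L.yo b) (L.yo a) F).comp (L.yoMapFunctor a b))).postcomp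
        ((FunCell.hcompBifunctor (P.Hom (L.yo a) F) (P.Hom (L.yo b) G) (G.obj b)).flip.fix
          (yonedaFunctor b G)))
    (((FunCell.hcompBifunctor (F.obj a) (F.obj b) (G.obj b)).precomp
      (compAtFunctor F G b) (presheafMapFunctor F a b)).postcomp
        ((FunCell.hcompBifunctor (P.Hom (L.yo a) F) (F.obj a) (G.obj b)).fix
          (yonedaFunctor a F))) (fun n α f τ => ?_) α f
  refine (FunCell.hcomp_act _ _ _).trans ((FunCell.cell_act _ _).trans ?_)
  refine (yonedaEval_homMap f α τ).trans (Eq.symm ?_)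
  refine (FunCell.hcomp_act _ _ _).trans ((FunCell.hcomp_act _ _ _).trans ?_)
  exact congrArg (fun y => FunCell.act (compAt α b) (FunCell.act (presheafMap F f) y))
    (FunCell.cell_act (yonedaFunctor a F) τ)

end

theorem proposition3p3 (L : InfCat.{u}) :
    ∃ Φ : ∀ (a : L.C 0) (F : InfFunctor L.op InfCAT.{u}),
        InfIso ((FunCat L.op InfCAT.{u}).Hom (L.yo a) F) (F.obj a),
      (∀ (a : L.C 0) (F : InfFunctor L.op InfCAT.{u}) (n : ℕ)
        (τ : ((FunCat L.op InfCAT.{u}).Hom (L.yo a) F).C n),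
        (Φ a F).hom.map τ = yonedaEval τ) ∧
      ∀ (a b : L.C 0) (F G : InfFunctor L.op InfCAT.{u}) (n : ℕ) (f : (L.Hom b a).C n)
        (α : ((FunCat L.op InfCAT.{u}).Hom F G).C n),
        ((Φ b G).hom.cell n).hcomp ((FunCat L.op InfCAT.{u}).homMap (L.yoMap f) α) =
          ((compAt α b).hcomp (presheafMap F f)).hcomp ((Φ a F).hom.cell n) :=
  ⟨yonedaIso, fun _ _ _ _ => rfl, fun a b F G _ f α => yoneda_natural a b F G f α⟩
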